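/- Let $R$ be a commutative ring with unit and let $r\ge 0$ be an integer. Conventions. A multicomplex $A$ is a bigraded $R$-module $\{A^{p,q}\}_{p,q\in\mathbb Z}$ with maps $d_i$ ($i\ge 0$) of bidegree $(-i,1-i)$ such that $\sum_{i+j=l}(-1)^i d_id_j=0$ for all $l\ge 0$; morphisms are bidegree $(0,0)$ maps commuting with all $d_i$. A spectral sequence is a family of bigraded $R$-modules $A_m$ ($m\ge 0$) with differentials $d_m$ of bidegree $(-m,1-m)$, together with isomorphisms $H_*(A_m)\cong A_{m+1}$; morphisms are families of chain maps compatible with these isomorphisms. The spectral sequence $E(A)$ of a multicomplex $A$ is that of the filtered complex $\mathrm{Tot}(A)^n=\prod_{i\le 0}A^{i,n+i}\oplus\bigoplus_{i>0}A^{i,n+i}$, $F_p\mathrm{Tot}(A)^n=\prod_{i\le p}A^{i,n+i}$ (families in $\mathrm{Tot}(A)^n$ vanishing for $i>p$), $(da)_j=\sum_{m\ge0}(-1)^{mn}d_m(a_{j+m})$: that is, $E_m^{p,q}(A)=Z_m^{p,q}/B_m^{p,q}$, where, with $n=q-p$, $Z_m^{p,q}=F_p\mathrm{Tot}(A)^n\cap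 d^{-1}(F_{p-m}\mathrm{Tot}(A)^{n+1})$, $B_0^{p,q}=Z_0^{p-1,q-1}$ and $B_m^{p,q}=Z_{m-1}^{p-1,q-1}+dZ_{m-1}^{p+m-1,q+m-2}$ for $m\ge1$, with the usual isomorphisms $H_*(E_m)\cong E_{m+1}$; the differential of the $m$-th page is normalised to have leading term $+d_m$, i.e. $\delta_m[a]=(-1)^{m(q-p)}[da]$ for $[a]\in E_m^{p,q}(A)$. The $r$-path $P_r(A)$ of a multicomplex $A$ is the multicomplex $P_r(A)^{p,q}=A^{p,q}\oplus A^{p+r,q+r-1}\oplus A^{p,q}$ with $D_i(x,y,z)=(d_ix,(-1)^{i+r+1}d_iy,d_iz)$ for $i\ne r$ and $D_r(x,y,z)=(d_rx,-x-d_ry+z,d_rz)$. The $r$-path $P(r;A)$ of a spectral sequence $A$ has pages $P_m(r;A)^{p,q}=A_m^{p,q}\oplus A_m^{p+r,q+r-1}\oplus A_m^{p,q}$ for $m\le r$ and $P_m(r;A)=A_m$ for $m>r$, with $D_m(x,y,z)=(d_mx,(-1)^{m+r+1}d_my,d_mz)$ for $m<r$, $D_r(x,y,z)=(d_rx,-x-d_ry+z,d_rz)$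 and $D_m=d_m$ for $m>r$; the isomorphisms $H_*(P_m(r;A))\cong P_{m+1}(r;A)$ are those of $A$ in each component for $m<r$, $[(x,y,z)]\mapsto[x]=[z]$ for $m=r$, and those of $A$ for $m>r$. In both cases a morphism $f$ induces $(f,f,f)$ on triples (and $f_m$ on the pages $m>r$ of the $r$-path of a spectral sequence), and the structure maps are $\iota(x)=(x,0,x)$, $\partial^-(x,y,z)=x$, $\partial^+(x,y,z)=z$ (on pages $m>r$ they are the identity). Proposition. There is an isomorphism of spectral sequences $\Phi_A:E(P_r(A))\xrightarrow{\ \cong\ }P(r;E(A))$, natural in the multicomplex $A$, such that $\Phi_A\circ E(\iota_A)=\iota_{E(A)}$, $\ \partial^-_{E(A)}\circ\Phi_A=E(\partial^-_A)$ and $\partial^+_{E(A)}\circ\Phi_A=E(\partial^+_A)$. -/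

import Mathlib

open CategoryTheory
universe u v

namespace SpecSeqPath

section Homology
variable {R : Type u} [CommRing R] {κ : Type} {c : ComplexShape κ}

/-- The class map from (concrete) cycles to homology. -/
noncomputable def cycleClass (K : HomologicalComplex (ModuleCat.{v} R) c) {i j : κ}
    (hij : c.Rel i j) : LinearMap.ker (K.d i j).hom →ₗ[R] K.homology i :=
  (K.liftCycles (ModuleCat.ofHom (LinearMap.ker (K.d i j).hom).subtype) j (c.next_eq' hij)
    (by ext x; exact x.2) ≫ K.homologyπ i).hom

lemma iCycles_lift (K : HomologicalComplex (ModuleCat.{v} R) c) {i j : κ}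
    (hij : c.Rel i j) (x : LinearMap.ker (K.d i j).hom) :
    (K.iCycles i).hom ((K.liftCycles (ModuleCat.ofHom (LinearMap.ker (K.d i j).hom).subtype) j
      (c.next_eq' hij) (by ext x; exact x.2)).hom x) = x.1 := by
  rw [← ModuleCat.comp_apply, HomologicalComplex.liftCycles_i]
  rfl

lemma iCycles_injective (K : HomologicalComplex (ModuleCat.{v} R) c) (i : κ) :
    Function.Injective (K.iCycles i).hom :=
  (ModuleCat.mono_iff_injective (K.iCycles i)).1 inferInstance

lemma cycleClass_surjective (K : HomologicalComplex (ModuleCat.{v} R) c) {i j : κ}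
    (hij : c.Rel i j) : Function.Surjective (cycleClass K hij) := by
  intro y
  obtain ⟨z, rfl⟩ := (ModuleCat.epi_iff_surjective (K.homologyπ i)).1 inferInstance y
  have hz : (K.iCycles i).hom z ∈ LinearMap.ker (K.d i j).hom := by
    rw [LinearMap.mem_ker, ← ModuleCat.comp_apply, HomologicalComplex.iCycles_d]; rfl
  refine ⟨⟨_, hz⟩, ?_⟩
  refine congrArg (K.homologyπ i).hom (iCycles_injective K i ?_)
  exact iCycles_lift K hij ⟨_, hz⟩

lemma cycleClass_eq_zero_iff (K : HomologicalComplex (ModuleCat.{v} R) c) {k i j : κ}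
    (hki : c.Rel k i) (hij : c.Rel i j) (x : LinearMap.ker (K.d i j).hom) :
    cycleClass K hij x = 0 ↔ ∃ y, (K.d k i).hom y = x.1 := by
  have hex : (ShortComplex.mk (K.toCycles k i) (K.homologyπ i) (by simp)).Exact :=
    ShortComplex.exact_of_g_is_cokernel _ (K.homologyIsCokernel k i (c.prev_eq' hki))
  rw [ShortComplex.moduleCat_exact_iff] at hex
  constructor
  · intro h
    obtain ⟨y, hy⟩ := hex _ h
    refine ⟨y, ?_⟩
    rw [← iCycles_lift K hij x, ← K.toCycles_i k i]
    exact congrArg (K.iCycles i).hom hy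
  · rintro ⟨y, hy⟩
    have : (K.toCycles k i).hom y = (K.liftCycles (ModuleCat.ofHom
        (LinearMap.ker (K.d i j).hom).subtype) j (c.next_eq' hij) (by ext x; exact x.2)).hom x := by
      apply iCycles_injective K i
      rw [iCycles_lift K hij x, ← hy, ← K.toCycles_i k i]; rfl
    change (K.homologyπ i).hom _ = 0
    erw [← this]
    rw [← ModuleCat.comp_apply, HomologicalComplex.toCycles_comp_homologyπ]; rfl

lemma homologyMap_cycleClass {K L : HomologicalComplex (ModuleCat.{v} R) c} (f : K ⟶ L) {i j : κ}
    (hij : c.Rel i j) (x : LinearMap.ker (K.d i j).hom)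
    (hx : (f.f i).hom x.1 ∈ LinearMap.ker (L.d i j).hom) :
    (HomologicalComplex.homologyMap f i).hom (cycleClass K hij x) =
      cycleClass L hij ⟨(f.f i).hom x.1, hx⟩ := by
  have h1 : (HomologicalComplex.cyclesMap f i).hom ((K.liftCycles (ModuleCat.ofHom
      (LinearMap.ker (K.d i j).hom).subtype) j (c.next_eq' hij) (by ext x; exact x.2)).hom x) =
      (L.liftCycles (ModuleCat.ofHom (LinearMap.ker (L.d i j).hom).subtype) j
      (c.next_eq' hij) (by ext x; exact x.2)).hom ⟨(f.f i).hom x.1, hx⟩ := by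
    apply iCycles_injective L i
    rw [iCycles_lift L hij, ← ModuleCat.comp_apply, HomologicalComplex.cyclesMap_i,
      ModuleCat.comp_apply, iCycles_lift K hij]
  change (HomologicalComplex.homologyMap f i).hom ((K.homologyπ i).hom _) = (L.homologyπ i).hom _
  rw [← ModuleCat.comp_apply, HomologicalComplex.homologyπ_naturality]
  exact congrArg (L.homologyπ i).hom h1

/-- If `ψ : Z → K_i` has values in cycles, every cycle is homologous to some `ψ a`, and `ψ a` is a
boundary exactly when `π a = 0`, where `π : Z → M` is onto, then `H_i(K) ≅ M` by `[ψ a] ↦ π a`. -/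
noncomputable def homologyIso (K : HomologicalComplex (ModuleCat.{v} R) c) {k i j : κ}
    (hki : c.Rel k i) (hij : c.Rel i j) {Z : Type v} [AddCommGroup Z] [Module R Z]
    {M : ModuleCat.{v} R} (ψ : Z →ₗ[R] K.X i) (π : Z →ₗ[R] M)
    (hψ : ∀ a, ψ a ∈ LinearMap.ker (K.d i j).hom) (hπ : Function.Surjective π)
    (hs : ∀ x, (K.d i j).hom x = 0 → ∃ a y, (K.d k i).hom y = x - ψ a)
    (hk : ∀ a, π a = 0 ↔ ∃ y, (K.d k i).hom y = ψ a) : K.homology i ≅ M :=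
  LinearEquiv.toModuleIso <|
    ((Submodule.quotEquivOfEq (LinearMap.ker π)
      (LinearMap.ker (cycleClass K hij ∘ₗ ψ.codRestrict _ hψ)) (by
        ext a
        rw [LinearMap.mem_ker, LinearMap.mem_ker, hk a, LinearMap.comp_apply,
          cycleClass_eq_zero_iff K hki hij]
        rfl)).trans
      (LinearMap.quotKerEquivOfSurjective (cycleClass K hij ∘ₗ ψ.codRestrict _ hψ) (by
        intro h
        obtain ⟨x, rfl⟩ := cycleClass_surjective K hij h
        obtain ⟨a, y, hy⟩ := hs x.1 x.2
        refine ⟨a, ?_⟩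
        rw [LinearMap.comp_apply, eq_comm, ← sub_eq_zero, ← map_sub,
          cycleClass_eq_zero_iff K hki hij]
        exact ⟨y, hy⟩))).symm.trans
    (LinearMap.quotKerEquivOfSurjective π hπ)

lemma homologyIso_cycleClass (K : HomologicalComplex (ModuleCat.{v} R) c) {k i j : κ}
    (hki : c.Rel k i) (hij : c.Rel i j) {Z : Type v} [AddCommGroup Z] [Module R Z]
    {M : ModuleCat.{v} R} (ψ : Z →ₗ[R] K.X i) (π : Z →ₗ[R] M)
    (hψ : ∀ a, ψ a ∈ LinearMap.ker (K.d i j).hom) (hπ : Function.Surjective π)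
    (hs : ∀ x, (K.d i j).hom x = 0 → ∃ a y, (K.d k i).hom y = x - ψ a)
    (hk : ∀ a, π a = 0 ↔ ∃ y, (K.d k i).hom y = ψ a) (a : Z) (x : LinearMap.ker (K.d i j).hom)
    (hx : x.1 = ψ a) :
    (homologyIso K hki hij ψ π hψ hπ hs hk).hom.hom (cycleClass K hij x) = π a := by
  obtain rfl : x = ⟨ψ a, hψ a⟩ := Subtype.ext hx
  change LinearMap.quotKerEquivOfSurjective π hπ _ = _
  rw [← LinearMap.quotKerEquivOfSurjective_apply_mk π hπ]
  congr 1
  change LinearEquiv.symm _ _ = _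
  rw [LinearEquiv.symm_apply_eq]
  rfl

/-- To compare two maps out of homology it is enough to compare them on classes of cycles. -/
lemma homology_hom_ext (K : HomologicalComplex (ModuleCat.{v} R) c) {i j : κ}
    (hij : c.Rel i j) {M : ModuleCat.{v} R} (f g : K.homology i ⟶ M)
    (h : ∀ x, f.hom (cycleClass K hij x) = g.hom (cycleClass K hij x)) : f = g := by
  ext y
  obtain ⟨x, rfl⟩ := cycleClass_surjective K hij y
  exact h x

lemma homologyIso_natural {K L : HomologicalComplex (ModuleCat.{v} R) c} {k i j : κ}
    (hki : c.Rel k i) (hij : c.Rel i j)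
    {Z : Type v} [AddCommGroup Z] [Module R Z] {M : ModuleCat.{v} R}
    {ψ : Z →ₗ[R] K.X i} {π : Z →ₗ[R] M}
    {hψ : ∀ a, ψ a ∈ LinearMap.ker (K.d i j).hom} {hπ : Function.Surjective π}
    {hs : ∀ x, (K.d i j).hom x = 0 → ∃ a y, (K.d k i).hom y = x - ψ a}
    {hk : ∀ a, π a = 0 ↔ ∃ y, (K.d k i).hom y = ψ a}
    {Z' : Type v} [AddCommGroup Z'] [Module R Z'] {M' : ModuleCat.{v} R}
    {ψ' : Z' →ₗ[R] L.X i} {π' : Z' →ₗ[R] M'}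
    {hψ' : ∀ a, ψ' a ∈ LinearMap.ker (L.d i j).hom} {hπ' : Function.Surjective π'}
    {hs' : ∀ x, (L.d i j).hom x = 0 → ∃ a y, (L.d k i).hom y = x - ψ' a}
    {hk' : ∀ a, π' a = 0 ↔ ∃ y, (L.d k i).hom y = ψ' a}
    (f : K ⟶ L) (g : M ⟶ M')
    (h : ∀ a, ∃ a', (f.f i).hom (ψ a) = ψ' a' ∧ g.hom (π a) = π' a') :
    HomologicalComplex.homologyMap f i ≫ (homologyIso L hki hij ψ' π' hψ' hπ' hs' hk').hom =
      (homologyIso K hki hij ψ π hψ hπ hs hk).hom ≫ g := by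
  ext y
  obtain ⟨x, rfl⟩ := cycleClass_surjective K hij y
  obtain ⟨a, y, hy⟩ := hs x.1 x.2
  have hx : cycleClass K hij x = cycleClass K hij ⟨ψ a, hψ a⟩ := by
    rw [← sub_eq_zero, ← map_sub, cycleClass_eq_zero_iff K hki hij]
    exact ⟨y, hy⟩
  obtain ⟨a', h1, h2⟩ := h a
  have hker : (f.f i).hom (ψ a) ∈ LinearMap.ker (L.d i j).hom := by rw [h1]; exact hψ' a'
  rw [hx, ModuleCat.comp_apply, ModuleCat.comp_apply, homologyMap_cycleClass f hij _ hker,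
    homologyIso_cycleClass K hki hij ψ π hψ hπ hs hk a _ rfl,
    homologyIso_cycleClass L hki hij ψ' π' hψ' hπ' hs' hk' a' _ h1, h2]

end Homology

section SpectralSequences
variable (R : Type u) [CommRing R]

/-- The shape of an `m`-bigraded complex: differentials have bidegree `(-m, 1 - m)`. -/
abbrev shape (m : ℤ) : ComplexShape (ℤ × ℤ) := ComplexShape.up' ((-m, 1 - m) : ℤ × ℤ)

/-- The category of `m`-bigraded complexes of `R`-modules. -/
abbrev BigradedComplex (m : ℤ) := HomologicalComplex (ModuleCat.{v} R) (shape m)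

/-- The category of spectral sequences of `R`-modules, with pages `m ≥ 0` and differentials of
bidegree `(-m, 1 - m)` on the page `m`. -/
abbrev SpSe := SpectralSequence (ModuleCat.{v} R) shape 0

variable {R}

lemma shape_prev (m : ℤ) (pq : ℤ × ℤ) : (shape m).Rel (pq - (-m, 1 - m)) pq := sub_add_cancel _ _

lemma shape_next (m : ℤ) (pq : ℤ × ℤ) : (shape m).Rel pq (pq + (-m, 1 - m)) := rfl

/-- A cycle of the page `m` of a spectral sequence is sent to the corresponding element of
the page `m + 1` by the characteristic map. -/
noncomputable def charMap (A : SpSe.{u, v} R) (m m' : ℤ) (hm : m + 1 = m') (h0 : 0 ≤ m)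
    {i j : ℤ × ℤ} (hij : (shape m).Rel i j) :
    LinearMap.ker ((A.page m).d i j).hom →ₗ[R] (A.page m').X i :=
  (A.iso m m' i).hom.hom ∘ₗ cycleClass (A.page m) hij

lemma char_surjective (A : SpSe.{u, v} R) (m m' : ℤ) (hm : m + 1 = m') (h0 : 0 ≤ m)
    {i j : ℤ × ℤ} (hij : (shape m).Rel i j) : Function.Surjective (charMap A m m' hm h0 hij) := by
  intro y
  obtain ⟨x, hx⟩ := cycleClass_surjective (A.page m) hij ((A.iso m m' i).inv.hom y)
  refine ⟨x, ?_⟩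
  change (A.iso m m' i).hom.hom (cycleClass (A.page m) hij x) = y
  rw [hx, ← ModuleCat.comp_apply, Iso.inv_hom_id]
  rfl

lemma char_eq_zero_iff (A : SpSe.{u, v} R) (m m' : ℤ) (hm : m + 1 = m') (h0 : 0 ≤ m)
    {k i j : ℤ × ℤ} (hki : (shape m).Rel k i) (hij : (shape m).Rel i j)
    (x : LinearMap.ker ((A.page m).d i j).hom) :
    charMap A m m' hm h0 hij x = 0 ↔ ∃ y, ((A.page m).d k i).hom y = x.1 := by
  rw [← cycleClass_eq_zero_iff (A.page m) hki hij]
  change (A.iso m m' i).hom.hom _ = 0 ↔ _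
  constructor
  · intro h
    have := congrArg (A.iso m m' i).inv.hom h
    rwa [← ModuleCat.comp_apply, Iso.hom_inv_id, map_zero] at this
  · intro h
    rw [h, map_zero]

lemma map_mem_ker {m : ℤ} {K L : BigradedComplex.{u, v} R m} (f : K ⟶ L) {i j : ℤ × ℤ}
    {x : K.X i} (hx : x ∈ LinearMap.ker (K.d i j).hom) :
    (f.f i).hom x ∈ LinearMap.ker (L.d i j).hom := by
  rw [LinearMap.mem_ker] at hx ⊢
  rw [← ModuleCat.comp_apply, f.comm, ModuleCat.comp_apply, hx, map_zero]

lemma hom_char {A B : SpSe.{u, v} R} (f : A ⟶ B) (m m' : ℤ) (hm : m + 1 = m') (h0 : 0 ≤ m)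
    {i j : ℤ × ℤ} (hij : (shape m).Rel i j) (x : LinearMap.ker ((A.page m).d i j).hom) :
    ((f.hom m').f i).hom (charMap A m m' hm h0 hij x) =
      charMap B m m' hm h0 hij ⟨((f.hom m).f i).hom x.1, map_mem_ker (f.hom m) x.2⟩ := by
  have h := f.comm m m' i
  change ((A.iso m m' i).hom ≫ (f.hom m').f i).hom _ = (B.iso m m' i).hom.hom _
  rw [← h, ← homologyMap_cycleClass (f.hom m) hij x]
  rfl

/-! ### Changing the signs of the differentials -/

/-- The sign `(-1) ^ (m * n)`, where `n = q - p`, attached to the bidegree `(p, q)`. -/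
def twistSign (m : ℤ) (pq : ℤ × ℤ) : ℤˣ := (m * (pq.2 - pq.1)).negOnePow

/-- Multiply the differential of an `m`-bigraded complex by `(-1) ^ (m * (q - p))` in each source
bidegree `(p, q)`. -/
@[simps]
def twistPage {m : ℤ} (K : BigradedComplex.{u, v} R m) : BigradedComplex.{u, v} R m where
  X := K.X
  d i j := ((twistSign m i : ℤˣ) : ℤ) • K.d i j
  shape i j h := by rw [K.shape i j h, smul_zero]
  d_comp_d' i j k _ _ := by
    rw [Preadditive.zsmul_comp, Preadditive.comp_zsmul, K.d_comp_d, smul_zero, smul_zero]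

lemma units_zsmul_eq_zero_iff {M : Type v} [AddCommGroup M] (s : ℤˣ) (x : M) :
    ((s : ℤˣ) : ℤ) • x = 0 ↔ x = 0 := by
  rcases Int.units_eq_one_or s with rfl | rfl <;> simp

lemma units_zsmul_zsmul {M : Type v} [AddCommGroup M] (s : ℤˣ) (x : M) :
    ((s : ℤˣ) : ℤ) • ((s : ℤˣ) : ℤ) • x = x := by
  rcases Int.units_eq_one_or s with rfl | rfl <;> simp

lemma twistPage_d_apply {m : ℤ} (K : BigradedComplex.{u, v} R m) (i j : ℤ × ℤ) (x : K.X i) :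
    ((twistPage K).d i j).hom x = ((twistSign m i : ℤˣ) : ℤ) • (K.d i j).hom x := rfl

lemma mem_ker_twistPage {m : ℤ} (K : BigradedComplex.{u, v} R m) (i j : ℤ × ℤ) (x : K.X i) :
    x ∈ LinearMap.ker ((twistPage K).d i j).hom ↔ x ∈ LinearMap.ker (K.d i j).hom := by
  exact units_zsmul_eq_zero_iff (twistSign m i) ((K.d i j).hom x)

lemma exists_twistPage {m : ℤ} (K : BigradedComplex.{u, v} R m) (k i : ℤ × ℤ) (x : K.X i) :
    (∃ y, ((twistPage K).d k i).hom y = x) ↔ ∃ y, (K.d k i).hom y = x := by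
  constructor
  · rintro ⟨y, hy⟩
    exact ⟨((twistSign m k : ℤˣ) : ℤ) • (show K.X k from y), (map_zsmul (K.d k i).hom _ _).trans hy⟩
  · rintro ⟨y, hy⟩
    refine ⟨((twistSign m k : ℤˣ) : ℤ) • y, ?_⟩
    refine (congrArg (((twistSign m k : ℤˣ) : ℤ) • ·) (map_zsmul (K.d k i).hom _ y)).trans ?_
    rw [hy]
    exact units_zsmul_zsmul _ _

/-- The functor on `m`-bigraded complexes multiplying the differential by `(-1) ^ (m * (q - p))`
in the source bidegree `(p, q)`. -/
@[simps]
def twistPageFunctor (m : ℤ) : BigradedComplex.{u, v} R m ⥤ BigradedComplex.{u, v} R m where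
  obj := twistPage
  map f :=
    { f := f.f
      comm' := fun i j _ => by
        change f.f i ≫ (((twistSign m i : ℤˣ) : ℤ) • _) = (((twistSign m i : ℤˣ) : ℤ) • _) ≫ f.f j
        rw [Preadditive.comp_zsmul, Preadditive.zsmul_comp, f.comm] }

/-- The characteristic maps after the change of signs: cycles and boundaries are the same as
before, and so is the isomorphism. -/
noncomputable def twistIso (A : SpSe.{u, v} R) (m m' : ℤ) (pq : ℤ × ℤ) (hm : m + 1 = m')
    (h0 : 0 ≤ m) : (twistPage (A.page m)).homology pq ≅ (A.page m').X pq :=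
  homologyIso (twistPage (A.page m)) (shape_prev m pq) (shape_next m pq)
    (LinearMap.ker ((A.page m).d pq (pq + (-m, 1 - m))).hom).subtype
    (charMap A m m' hm h0 (shape_next m pq))
    (fun a => (mem_ker_twistPage _ _ _ _).2 a.2)
    (char_surjective A m m' hm h0 _)
    (fun x hx => ⟨⟨x, (mem_ker_twistPage _ _ _ _).1 hx⟩, 0,
      (map_zero _).trans (sub_self x).symm⟩)
    (fun a => (char_eq_zero_iff A m m' hm h0 (shape_prev m pq) _ a).trans
      (exists_twistPage _ _ _ _).symm)

lemma twistIso_natural {A B : SpSe.{u, v} R} (f : A ⟶ B) (m m' : ℤ) (pq : ℤ × ℤ)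
    (hm : m + 1 = m') (h0 : 0 ≤ m) :
    HomologicalComplex.homologyMap ((twistPageFunctor m).map (f.hom m)) pq ≫
      (twistIso B m m' pq hm h0).hom = (twistIso A m m' pq hm h0).hom ≫ (f.hom m').f pq := by
  unfold twistIso
  exact homologyIso_natural (shape_prev m pq) (shape_next m pq)
    ((twistPageFunctor m).map (f.hom m)) ((f.hom m').f pq)
    fun a => ⟨⟨((f.hom m).f pq).hom a.1, map_mem_ker (f.hom m) a.2⟩, rfl,
      hom_char f m m' hm h0 _ a⟩

/-- The functor on spectral sequences which multiplies the differential of the page `m` by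
`(-1) ^ (m * (q - p))` in the source bidegree `(p, q)`; the bigraded modules on the pages, the
characteristic maps and the morphisms are unchanged. -/
noncomputable def signTwist : SpSe.{u, v} R ⥤ SpSe.{u, v} R where
  obj A :=
    { page := fun m _ => twistPage (A.page m)
      iso := fun m m' pq hm h0 => twistIso A m m' pq hm h0 }
  map {A B} f :=
    { hom := fun m _ => (twistPageFunctor m).map (f.hom m)
      comm := fun m m' pq hm h0 => twistIso_natural f m m' pq hm h0 }
  map_id A := rfl
  map_comp f g := rfl

/-! ### The `r`-path of a spectral sequence -/

/-- The shift `(r, r - 1)`. -/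
def pathShift (r : ℕ) : ℤ × ℤ := ((r : ℤ), (r : ℤ) - 1)

/-- For a family of modules `X`, the map `X i → X (j + (r, r - 1))` which is the identity if
`m = r` and `i = j + (r, r - 1)`, and which is zero otherwise. -/
noncomputable def conn (r : ℕ) (m : ℤ) (X : ℤ × ℤ → ModuleCat.{v} R) (i j : ℤ × ℤ) :
    X i ⟶ X (j + pathShift r) :=
  open Classical in
  if h : m = r ∧ i = j + pathShift r then eqToHom (congrArg X h.2) else 0

/-- The sign `(-1) ^ (m + r + 1)`. -/
def pathSign (r : ℕ) (m : ℤ) : ℤ := ((m + r + 1).negOnePow : ℤˣ)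

/-- The map `(x, y, z) ↦ (f x, s • g y + e (z - x), f z)`. -/
def pathMap {M₁ M₂ N₁ N₂ : Type v} [AddCommGroup M₁] [Module R M₁] [AddCommGroup M₂] [Module R M₂]
    [AddCommGroup N₁] [Module R N₁] [AddCommGroup N₂] [Module R N₂]
    (f : M₁ →ₗ[R] N₁) (g : M₂ →ₗ[R] N₂) (s : ℤ) (e : M₁ →ₗ[R] N₂) :
    (M₁ × M₂ × M₁) →ₗ[R] (N₁ × N₂ × N₁) where
  toFun w := (f w.1, s • g w.2.1 + e (w.2.2 - w.1), f w.2.2)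
  map_add' w w' := by
    refine Prod.ext (map_add _ _ _) (Prod.ext ?_ (map_add _ _ _))
    simp only [Prod.fst_add, Prod.snd_add, map_add, smul_add, map_sub]
    abel
  map_smul' a w := by
    refine Prod.ext (map_smul _ _ _) (Prod.ext ?_ (map_smul _ _ _))
    simp only [Prod.smul_fst, Prod.smul_snd, map_smul, map_sub, RingHom.id_apply, smul_add,
      smul_sub, smul_comm s a]

/-- The map `(x, y, z) ↦ (f x, g y, f z)`. -/
def tripleMap {M₁ M₂ N₁ N₂ : Type v} [AddCommGroup M₁] [Module R M₁] [AddCommGroup M₂] [Module R M₂]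
    [AddCommGroup N₁] [Module R N₁] [AddCommGroup N₂] [Module R N₂]
    (f : M₁ →ₗ[R] N₁) (g : M₂ →ₗ[R] N₂) : (M₁ × M₂ × M₁) →ₗ[R] (N₁ × N₂ × N₁) :=
  f.prodMap (g.prodMap f)

lemma conn_comp (r : ℕ) (m : ℤ) {X : ℤ × ℤ → ModuleCat.{v} R} {Y : ℤ × ℤ → ModuleCat.{v} R}
    (f : ∀ i, X i ⟶ Y i) (i j : ℤ × ℤ) :
    conn r m X i j ≫ f (j + pathShift r) = f i ≫ conn r m Y i j := by
  unfold conn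
  split_ifs with h
  · obtain ⟨-, rfl⟩ := h
    simp
  · simp

lemma conn_of_ne {r : ℕ} {m : ℤ} (h : m ≠ r) (X : ℤ × ℤ → ModuleCat.{v} R) (i j : ℤ × ℤ) :
    conn r m X i j = 0 := by
  unfold conn
  rw [dif_neg fun h' => h h'.1]

lemma pathSign_self (r : ℕ) : pathSign r (r : ℤ) = -1 := by
  unfold pathSign
  rw [Int.negOnePow_odd _ ⟨(r : ℤ), by ring⟩]; rfl

lemma eq_add_pathShift {r : ℕ} {m : ℤ} (hm : m = r) {i j : ℤ × ℤ} (h : (shape m).Rel i j) :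
    i = j + pathShift r := by
  have e : ((-m, 1 - m) : ℤ × ℤ) = - pathShift r := by simp [pathShift, hm]
  rw [← (show i + _ = j from h), e]
  abel

lemma conn_comp_d (r : ℕ) {m : ℤ} (K : BigradedComplex.{u, v} R m) {i j k : ℤ × ℤ}
    (hij : (shape m).Rel i j) (hjk : (shape m).Rel j k) :
    K.d i j ≫ conn r m K.X j k =
      conn r m K.X i j ≫ K.d (j + pathShift r) (k + pathShift r) := by
  by_cases hm : m = r
  · obtain rfl := eq_add_pathShift hm hjk
    obtain rfl := eq_add_pathShift hm hij
    simp [conn, hm]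
  · rw [conn_of_ne hm, conn_of_ne hm, Limits.comp_zero, Limits.zero_comp]

/-- The pages `m ≤ r` of the `r`-path: the `m`-bigraded complex
`K^{p,q} ⊕ K^{p+r,q+r-1} ⊕ K^{p,q}` with differential
`(x, y, z) ↦ (d x, (-1)^{m+r+1} d y, d z)` for `m < r`, and
`(x, y, z) ↦ (d x, - x - d y + z, d z)` for `m = r`. -/
noncomputable def lowPath (r : ℕ) {m : ℤ} (K : BigradedComplex.{u, v} R m) :
    BigradedComplex.{u, v} R m where
  X i := ModuleCat.of R (K.X i × K.X (i + pathShift r) × K.X i)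
  d i j := ModuleCat.ofHom <|
    pathMap (K.d i j).hom (K.d (i + pathShift r) (j + pathShift r)).hom (pathSign r m)
      (conn r m K.X i j).hom
  shape i j h := by
    have h1 : ¬ (shape m).Rel (i + pathShift r) (j + pathShift r) := fun h' => h <| by
      change i + _ = j
      change i + _ + _ = j + _ at h'
      rw [add_right_comm] at h'
      exact add_right_cancel h'
    have h2 : conn r m K.X i j = 0 := by
      unfold conn
      rw [dif_neg]
      rintro ⟨rfl, rfl⟩
      apply h
      change _ + _ + _ = _
      rw [add_assoc]
      convert add_zero j
      simp [pathShift]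
    rw [K.shape i j h, K.shape _ _ h1, h2]
    ext w <;> simp [pathMap]
  d_comp_d' i j k hij hjk := by
    refine ModuleCat.hom_ext (LinearMap.ext fun w => ?_)
    have hd : ∀ (a b c : ℤ × ℤ) (x : K.X a), (K.d b c).hom ((K.d a b).hom x) = 0 := by
      intro a b c x
      rw [← ModuleCat.comp_apply, K.d_comp_d]; rfl
    have hc : ∀ x : K.X i, (conn r m K.X j k).hom ((K.d i j).hom x) + pathSign r m •
        (K.d (j + pathShift r) (k + pathShift r)).hom ((conn r m K.X i j).hom x) = 0 := by
      intro x
      rw [← ModuleCat.comp_apply, ← ModuleCat.comp_apply, conn_comp_d r K hij hjk]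
      by_cases hm : m = r
      · have hs : pathSign r m = -1 := by rw [hm, pathSign_self]
        rw [hs, neg_one_zsmul, add_neg_cancel]
      · rw [conn_of_ne hm, Limits.zero_comp]
        simp
    refine Prod.ext (hd i j k w.1) (Prod.ext ?_ (hd i j k w.2.2))
    change pathSign r m • (K.d _ _).hom (pathSign r m • (K.d _ _).hom w.2.1 +
      (conn r m K.X i j).hom (w.2.2 - w.1)) + (conn r m K.X j k).hom
      ((K.d i j).hom w.2.2 - (K.d i j).hom w.1) = 0
    rw [← map_sub, map_add, map_zsmul, hd, smul_zero, zero_add]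
    exact (add_comm _ _).trans (hc _)

lemma lowPath_d_apply (r : ℕ) {m : ℤ} (K : BigradedComplex.{u, v} R m) (i j : ℤ × ℤ)
    (w : K.X i × K.X (i + pathShift r) × K.X i) :
    ((lowPath r K).d i j).hom w = ((K.d i j).hom w.1,
      pathSign r m • (K.d (i + pathShift r) (j + pathShift r)).hom w.2.1 +
        (conn r m K.X i j).hom (w.2.2 - w.1), (K.d i j).hom w.2.2) := rfl

/-- Functoriality of `lowPath`: a morphism `f` induces `(f, f, f)`. -/
noncomputable def lowPathFunctor (r : ℕ) (m : ℤ) :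
    BigradedComplex.{u, v} R m ⥤ BigradedComplex.{u, v} R m where
  obj K := lowPath r K
  map {K L} f :=
    { f := fun i => ModuleCat.ofHom (tripleMap (f.f i).hom (f.f (i + pathShift r)).hom)
      comm' := fun i j _ => by
        refine ModuleCat.hom_ext (LinearMap.ext fun w => ?_)
        have hd : ∀ (a b : ℤ × ℤ) (x : K.X a), (L.d a b).hom ((f.f a).hom x) =
            (f.f b).hom ((K.d a b).hom x) := by
          intro a b x
          rw [← ModuleCat.comp_apply, ← ModuleCat.comp_apply, f.comm]
        have hc : ∀ x : K.X i, (conn r m L.X i j).hom ((f.f i).hom x) =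
            (f.f (j + pathShift r)).hom ((conn r m K.X i j).hom x) := by
          intro x
          rw [← ModuleCat.comp_apply, ← ModuleCat.comp_apply, conn_comp]
        refine Prod.ext (hd i j w.1) (Prod.ext ?_ (hd i j w.2.2))
        change pathSign r m • (L.d _ _).hom ((f.f _).hom w.2.1) + (conn r m L.X i j).hom
          ((f.f i).hom w.2.2 - (f.f i).hom w.1) = (f.f _).hom (pathSign r m • (K.d _ _).hom w.2.1 +
          (conn r m K.X i j).hom (w.2.2 - w.1))
        rw [map_add, map_zsmul, hd, ← map_sub, hc] }
  map_id K := by ext i w; rfl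
  map_comp f g := by ext i w; rfl

/-- The inclusion `x ↦ (x, 0, x)`. -/
noncomputable def lowι (r : ℕ) (m : ℤ) : 𝟭 (BigradedComplex.{u, v} R m) ⟶ lowPathFunctor r m where
  app K :=
    { f := fun i => ModuleCat.ofHom (LinearMap.prod LinearMap.id (LinearMap.prod 0 LinearMap.id))
      comm' := fun i j _ => by
        ext x
        refine Prod.ext rfl (Prod.ext ?_ rfl)
        change pathSign r m • (K.d _ _).hom 0 + (conn r m K.X i j).hom (x - x) = 0
        rw [map_zero, smul_zero, sub_self, map_zero, add_zero] }
  naturality K L f := by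
    ext i x
    refine Prod.ext rfl (Prod.ext ?_ rfl)
    exact (map_zero (f.f (i + pathShift r)).hom).symm

/-- The projection `(x, y, z) ↦ x`. -/
noncomputable def lowMinus (r : ℕ) (m : ℤ) :
    lowPathFunctor r m ⟶ 𝟭 (BigradedComplex.{u, v} R m) where
  app K :=
    { f := fun i => ModuleCat.ofHom (LinearMap.fst R (K.X i) (K.X (i + pathShift r) × K.X i))
      comm' := fun i j _ => by ext x; rfl }
  naturality K L f := by ext i x; rfl

/-- The projection `(x, y, z) ↦ z`. -/
noncomputable def lowPlus (r : ℕ) (m : ℤ) :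
    lowPathFunctor r m ⟶ 𝟭 (BigradedComplex.{u, v} R m) where
  app K :=
    { f := fun i => ModuleCat.ofHom (LinearMap.snd R (K.X (i + pathShift r)) (K.X i) ∘ₗ
        LinearMap.snd R (K.X i) (K.X (i + pathShift r) × K.X i))
      comm' := fun i j _ => by ext x; rfl }
  naturality K L f := by ext i x; rfl

lemma shape_shift (r : ℕ) {m : ℤ} {i j : ℤ × ℤ} (h : (shape m).Rel i j) :
    (shape m).Rel (i + pathShift r) (j + pathShift r) := by
  change i + _ = j at h
  change i + _ + _ = j + _
  rw [add_right_comm, h]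

lemma pathSign_zsmul_zsmul (r : ℕ) (m : ℤ) {M : Type v} [AddCommGroup M] (x : M) :
    pathSign r m • pathSign r m • x = x := units_zsmul_zsmul _ x

lemma pathSign_zsmul_eq_zero_iff (r : ℕ) (m : ℤ) {M : Type v} [AddCommGroup M] (x : M) :
    pathSign r m • x = 0 ↔ x = 0 := units_zsmul_eq_zero_iff _ x

/-- The cycles of a page `m ≤ r` of the `r`-path. -/
noncomputable abbrev lowCycles (r : ℕ) {m : ℤ} (K : BigradedComplex.{u, v} R m) (i j : ℤ × ℤ) :
    Submodule R (K.X i × K.X (i + pathShift r) × K.X i) :=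
  LinearMap.ker ((lowPath r K).d i j).hom

/-- The first component of a cycle. -/
noncomputable def cycFst (r : ℕ) {m : ℤ} (K : BigradedComplex.{u, v} R m) (i j : ℤ × ℤ) :
    lowCycles r K i j →ₗ[R] LinearMap.ker (K.d i j).hom :=
  (LinearMap.fst R _ _ ∘ₗ (lowCycles r K i j).subtype).codRestrict _
    fun w => congrArg (fun t : K.X j × K.X (j + pathShift r) × K.X j => t.1) w.2

/-- The third component of a cycle. -/
noncomputable def cycSnd (r : ℕ) {m : ℤ} (K : BigradedComplex.{u, v} R m) (i j : ℤ × ℤ) :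
    lowCycles r K i j →ₗ[R] LinearMap.ker (K.d i j).hom :=
  (LinearMap.snd R _ _ ∘ₗ LinearMap.snd R _ _ ∘ₗ (lowCycles r K i j).subtype).codRestrict _
    fun w => congrArg (fun t : K.X j × K.X (j + pathShift r) × K.X j => t.2.2) w.2

/-- The second component of a cycle, for `m < r`. -/
noncomputable def cycMid (r : ℕ) {m : ℤ} (h : m ≠ r) (K : BigradedComplex.{u, v} R m) (i j : ℤ × ℤ) :
    lowCycles r K i j →ₗ[R]
      LinearMap.ker (K.d (i + pathShift r) (j + pathShift r)).hom :=
  (LinearMap.fst R _ _ ∘ₗ LinearMap.snd R _ _ ∘ₗ (lowCycles r K i j).subtype).codRestrict _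
    fun w => by
      have h1 := congrArg (fun t => t.2.1) w.2
      change pathSign r m • (K.d (i + pathShift r) (j + pathShift r)).hom w.1.2.1 +
        (conn r m K.X i j).hom (w.1.2.2 - w.1.1) = 0 at h1
      rw [conn_of_ne h, ModuleCat.hom_zero, LinearMap.zero_apply, add_zero,
        pathSign_zsmul_eq_zero_iff] at h1
      exact h1

lemma mem_lowCycles {r : ℕ} {m : ℤ} (h : m ≠ r) (K : BigradedComplex.{u, v} R m) (i j : ℤ × ℤ)
    (x : LinearMap.ker (K.d i j).hom)
    (y : LinearMap.ker (K.d (i + pathShift r) (j + pathShift r)).hom)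
    (z : LinearMap.ker (K.d i j).hom) :
    ((x.1, y.1, z.1) : K.X i × K.X (i + pathShift r) × K.X i) ∈ lowCycles r K i j := by
  refine Prod.ext x.2 (Prod.ext ?_ z.2)
  change pathSign r m • (K.d _ _).hom y.1 + (conn r m K.X i j).hom (z.1 - x.1) = 0
  rw [conn_of_ne h, y.2]
  simp

/-- The characteristic maps of the `r`-path from the page `m` to the page `m + 1` for `m < r`:
`[(x, y, z)] ↦ ([x], [y], [z])`. -/
noncomputable def lowIso (r : ℕ) (A : SpSe.{u, v} R) (m m' : ℤ) (pq : ℤ × ℤ) (hm : m + 1 = m')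
    (h0 : 0 ≤ m) (h : m ≠ r) :
    (lowPath r (A.page m h0)).homology pq ≅ (lowPath r (A.page m')).X pq :=
  homologyIso (lowPath r (A.page m h0)) (shape_prev m pq) (shape_next m pq)
    (lowCycles r (A.page m h0) pq (pq + (-m, 1 - m))).subtype
    (LinearMap.prod (charMap A m m' hm h0 (shape_next m pq) ∘ₗ cycFst r _ _ _)
      (LinearMap.prod
        (charMap A m m' hm h0 (shape_shift r (shape_next m pq)) ∘ₗ cycMid r h _ _ _)
        (charMap A m m' hm h0 (shape_next m pq) ∘ₗ cycSnd r _ _ _)))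
    (fun a => a.2)
    (by
      rintro ⟨x, y, z⟩
      obtain ⟨x, rfl⟩ := char_surjective A m m' hm h0 (shape_next m pq) x
      obtain ⟨y, rfl⟩ := char_surjective A m m' hm h0 (shape_shift r (shape_next m pq)) y
      obtain ⟨z, rfl⟩ := char_surjective A m m' hm h0 (shape_next m pq) z
      exact ⟨⟨_, mem_lowCycles h _ _ _ x y z⟩, rfl⟩)
    (fun x hx => ⟨⟨x, hx⟩, 0, (map_zero _).trans (sub_self x).symm⟩)
    (by
      intro a
      have e1 := char_eq_zero_iff A m m' hm h0 (shape_prev m pq) (shape_next m pq) (cycFst r _ _ _ a)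
      have e2 := char_eq_zero_iff A m m' hm h0 (shape_shift r (shape_prev m pq))
        (shape_shift r (shape_next m pq)) (cycMid r h _ _ _ a)
      have e3 := char_eq_zero_iff A m m' hm h0 (shape_prev m pq) (shape_next m pq) (cycSnd r _ _ _ a)
      constructor
      · intro ha
        obtain ⟨x, hx⟩ := e1.1 (congrArg (fun t => t.1) ha)
        obtain ⟨y, hy⟩ := e2.1 (congrArg (fun t => t.2.1) ha)
        obtain ⟨z, hz⟩ := e3.1 (congrArg (fun t => t.2.2) ha)
        refine ⟨(x, pathSign r m • y, z), Prod.ext hx (Prod.ext ?_ hz)⟩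
        change pathSign r m • ((A.page m h0).d _ _).hom (pathSign r m • y) +
          (conn r m (A.page m h0).X _ _).hom (z - x) = _
        rw [conn_of_ne h, ModuleCat.hom_zero, LinearMap.zero_apply, add_zero, map_zsmul,
          pathSign_zsmul_zsmul, hy]
        rfl
      · rintro ⟨⟨x, y, z⟩, hw⟩
        refine Prod.ext (e1.2 ⟨x, congrArg (fun t => t.1) hw⟩)
          (Prod.ext (e2.2 ⟨pathSign r m • y, ?_⟩) (e3.2 ⟨z, congrArg (fun t => t.2.2) hw⟩))
        have h1 := congrArg (fun t => t.2.1) hw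
        change pathSign r m • ((A.page m h0).d _ _).hom y +
          (conn r m (A.page m h0).X _ _).hom (z - x) = _ at h1
        rw [conn_of_ne h, ModuleCat.hom_zero, LinearMap.zero_apply, add_zero] at h1
        rw [map_zsmul, h1]
        rfl)

/-- On the page `r`, the connecting term `conn` is a bijection from the component of bidegree
`i` to the middle component in the target bidegree. -/
lemma conn_bijective (r : ℕ) {m : ℤ} (hr : m = r) (X : ℤ × ℤ → ModuleCat.{v} R) {i j : ℤ × ℤ}
    (hij : (shape m).Rel i j) : Function.Bijective (conn r m X i j).hom := by
  have e2 := eq_add_pathShift hr hij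
  subst e2
  unfold conn
  rw [dif_pos ⟨hr, rfl⟩]
  exact Function.bijective_id

/-- The characteristic map of the `r`-path from the page `r` to the page `r + 1`:
`[(x, y, z)] ↦ [x] = [z]`. -/
noncomputable def topIso (r : ℕ) (A : SpSe.{u, v} R) (m m' : ℤ) (pq : ℤ × ℤ) (hm : m + 1 = m')
    (h0 : 0 ≤ m) (h : m = r) :
    (lowPath r (A.page m h0)).homology pq ≅ (A.page m').X pq :=
  homologyIso (lowPath r (A.page m h0)) (shape_prev m pq) (shape_next m pq)
    (lowCycles r (A.page m h0) pq (pq + (-m, 1 - m))).subtype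
    (charMap A m m' hm h0 (shape_next m pq) ∘ₗ cycFst r _ _ _)
    (fun a => a.2)
    (by
      intro x
      obtain ⟨x, rfl⟩ := char_surjective A m m' hm h0 (shape_next m pq) x
      refine ⟨⟨(x.1, 0, x.1), Prod.ext x.2 (Prod.ext ?_ x.2)⟩, rfl⟩
      change pathSign r m • ((A.page m h0).d _ _).hom 0 + (conn r m _ _ _).hom (x.1 - x.1) = 0
      simp)
    (fun x hx => ⟨⟨x, hx⟩, 0, (map_zero _).trans (sub_self x).symm⟩)
    (by
      intro a
      have e1 := char_eq_zero_iff A m m' hm h0 (shape_prev m pq) (shape_next m pq) (cycFst r _ _ _ a)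
      refine Iff.trans e1 ⟨?_, ?_⟩
      · rintro ⟨x, hx⟩
        obtain ⟨w, hw⟩ := (conn_bijective r h (A.page m h0).X (shape_prev m pq)).2 a.1.2.1
        have ha := congrArg (fun t => t.2.1) a.2
        change pathSign r m • ((A.page m h0).d (pq + pathShift r) _).hom a.1.2.1 +
          (conn r m (A.page m h0).X _ _).hom (a.1.2.2 - a.1.1) = 0 at ha
        have hs : pathSign r m = -1 := by rw [h, pathSign_self]
        refine ⟨(x, 0, x + w), Prod.ext hx (Prod.ext ?_ ?_)⟩
        · change pathSign r m • ((A.page m h0).d _ _).hom 0 +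
            (conn r m (A.page m h0).X _ _).hom (x + w - x) = a.1.2.1
          rw [map_zero, smul_zero, zero_add, add_sub_cancel_left, hw]
        · change ((A.page m h0).d _ _).hom (x + w) = a.1.2.2
          have h2 : (conn r m (A.page m h0).X pq (pq + (-m, 1 - m))).hom
              (((A.page m h0).d (pq - (-m, 1 - m)) pq).hom w) =
              ((A.page m h0).d (pq + pathShift r) (pq + (-m, 1 - m) + pathShift r)).hom a.1.2.1 := by
            rw [← hw, ← ModuleCat.comp_apply, ← ModuleCat.comp_apply]
            rw [conn_comp_d r (A.page m h0) (shape_prev m pq) (shape_next m pq)]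
          rw [map_add, hx]
          change a.1.1 + _ = a.1.2.2
          rw [← eq_sub_iff_add_eq']
          apply (conn_bijective r h (A.page m h0).X (shape_next m pq)).1
          rw [h2]
          rw [hs, neg_one_zsmul, neg_add_eq_zero] at ha
          exact ha
      · rintro ⟨w, hw⟩
        exact ⟨w.1, congrArg (fun t => t.1) hw⟩)

lemma lowIso_natural (r : ℕ) {A B : SpSe.{u, v} R} (f : A ⟶ B) (m m' : ℤ) (pq : ℤ × ℤ)
    (hm : m + 1 = m') (h0 : 0 ≤ m) (h : m ≠ r) :
    HomologicalComplex.homologyMap ((lowPathFunctor r m).map (f.hom m)) pq ≫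
      (lowIso r B m m' pq hm h0 h).hom =
    (lowIso r A m m' pq hm h0 h).hom ≫ ((lowPathFunctor r m').map (f.hom m')).f pq := by
  unfold lowIso
  exact homologyIso_natural (shape_prev m pq) (shape_next m pq)
    ((lowPathFunctor r m).map (f.hom m)) (((lowPathFunctor r m').map (f.hom m')).f pq)
    fun a => ⟨⟨_, map_mem_ker ((lowPathFunctor r m).map (f.hom m)) a.2⟩, rfl,
      Prod.ext (hom_char f m m' hm h0 _ _)
        (Prod.ext (hom_char f m m' hm h0 _ _) (hom_char f m m' hm h0 _ _))⟩

lemma topIso_natural (r : ℕ) {A B : SpSe.{u, v} R} (f : A ⟶ B) (m m' : ℤ) (pq : ℤ × ℤ)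
    (hm : m + 1 = m') (h0 : 0 ≤ m) (h : m = r) :
    HomologicalComplex.homologyMap ((lowPathFunctor r m).map (f.hom m)) pq ≫
      (topIso r B m m' pq hm h0 h).hom =
    (topIso r A m m' pq hm h0 h).hom ≫ (f.hom m').f pq := by
  unfold topIso
  exact homologyIso_natural (shape_prev m pq) (shape_next m pq)
    ((lowPathFunctor r m).map (f.hom m)) ((f.hom m').f pq)
    fun a => ⟨⟨_, map_mem_ker ((lowPathFunctor r m).map (f.hom m)) a.2⟩, rfl,
      hom_char f m m' hm h0 _ _⟩

lemma lowIso_apply (r : ℕ) (A : SpSe.{u, v} R) (m m' : ℤ) (pq : ℤ × ℤ)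
    (hm : m + 1 = m') (h0 : 0 ≤ m) (h : m ≠ r)
    (a : lowCycles r (A.page m) pq (pq + (-m, 1 - m))) :
    (lowIso r A m m' pq hm h0 h).hom.hom
        (cycleClass (lowPath r (A.page m)) (shape_next m pq) a) =
      (charMap A m m' hm h0 (shape_next m pq) (cycFst r _ _ _ a),
        charMap A m m' hm h0 (shape_shift r (shape_next m pq)) (cycMid r h _ _ _ a),
        charMap A m m' hm h0 (shape_next m pq) (cycSnd r _ _ _ a)) :=
  homologyIso_cycleClass _ _ _ _ _ _ _ _ _ _ _ rfl

lemma topIso_apply (r : ℕ) (A : SpSe.{u, v} R) (m m' : ℤ) (pq : ℤ × ℤ)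
    (hm : m + 1 = m') (h0 : 0 ≤ m) (h : m = r)
    (a : lowCycles r (A.page m) pq (pq + (-m, 1 - m))) :
    (topIso r A m m' pq hm h0 h).hom.hom
        (cycleClass (lowPath r (A.page m)) (shape_next m pq) a) =
      charMap A m m' hm h0 (shape_next m pq) (cycFst r _ _ _ a) :=
  homologyIso_cycleClass _ _ _ _ _ _ _ _ _ _ _ rfl

lemma lowIso_ι (r : ℕ) (A : SpSe.{u, v} R) (m m' : ℤ) (pq : ℤ × ℤ)
    (hm : m + 1 = m') (h0 : 0 ≤ m) (h : m ≠ r) :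
    HomologicalComplex.homologyMap ((lowι r m).app (A.page m)) pq ≫
      (lowIso r A m m' pq hm h0 h).hom =
    (A.iso m m' pq).hom ≫ ((lowι r m').app (A.page m')).f pq := by
  refine homology_hom_ext _ (shape_next m pq) _ _ fun x => ?_
  have hx := map_mem_ker ((lowι r m).app (A.page m)) x.2
  refine (congrArg (lowIso r A m m' pq hm h0 h).hom.hom
    (homologyMap_cycleClass ((lowι r m).app (A.page m)) (shape_next m pq) x hx)).trans ?_
  refine (lowIso_apply r A m m' pq hm h0 h ⟨_, hx⟩).trans ?_
  exact Prod.ext rfl (Prod.ext (map_zero (charMap A m m' hm h0 _)) rfl)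

lemma topIso_ι (r : ℕ) (A : SpSe.{u, v} R) (m m' : ℤ) (pq : ℤ × ℤ)
    (hm : m + 1 = m') (h0 : 0 ≤ m) (h : m = r) :
    HomologicalComplex.homologyMap ((lowι r m).app (A.page m)) pq ≫
      (topIso r A m m' pq hm h0 h).hom = (A.iso m m' pq).hom := by
  refine homology_hom_ext _ (shape_next m pq) _ _ fun x => ?_
  have hx := map_mem_ker ((lowι r m).app (A.page m)) x.2
  refine (congrArg (topIso r A m m' pq hm h0 h).hom.hom
    (homologyMap_cycleClass ((lowι r m).app (A.page m)) (shape_next m pq) x hx)).trans ?_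
  exact topIso_apply r A m m' pq hm h0 h ⟨_, hx⟩

lemma lowIso_minus (r : ℕ) (A : SpSe.{u, v} R) (m m' : ℤ) (pq : ℤ × ℤ)
    (hm : m + 1 = m') (h0 : 0 ≤ m) (h : m ≠ r) :
    HomologicalComplex.homologyMap ((lowMinus r m).app (A.page m)) pq ≫ (A.iso m m' pq).hom =
    (lowIso r A m m' pq hm h0 h).hom ≫ ((lowMinus r m').app (A.page m')).f pq := by
  refine homology_hom_ext _ (shape_next m pq) _ _ fun x => ?_
  refine (congrArg (A.iso m m' pq).hom.hom (homologyMap_cycleClass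
    ((lowMinus r m).app (A.page m)) (shape_next m pq) x (map_mem_ker _ x.2))).trans ?_
  exact (congrArg (fun t => t.1) (lowIso_apply r A m m' pq hm h0 h x)).symm

lemma lowIso_plus (r : ℕ) (A : SpSe.{u, v} R) (m m' : ℤ) (pq : ℤ × ℤ)
    (hm : m + 1 = m') (h0 : 0 ≤ m) (h : m ≠ r) :
    HomologicalComplex.homologyMap ((lowPlus r m).app (A.page m)) pq ≫ (A.iso m m' pq).hom =
    (lowIso r A m m' pq hm h0 h).hom ≫ ((lowPlus r m').app (A.page m')).f pq := by
  refine homology_hom_ext _ (shape_next m pq) _ _ fun x => ?_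
  refine (congrArg (A.iso m m' pq).hom.hom (homologyMap_cycleClass
    ((lowPlus r m).app (A.page m)) (shape_next m pq) x (map_mem_ker _ x.2))).trans ?_
  exact (congrArg (fun t => t.2.2) (lowIso_apply r A m m' pq hm h0 h x)).symm

lemma topIso_minus (r : ℕ) (A : SpSe.{u, v} R) (m m' : ℤ) (pq : ℤ × ℤ)
    (hm : m + 1 = m') (h0 : 0 ≤ m) (h : m = r) :
    HomologicalComplex.homologyMap ((lowMinus r m).app (A.page m)) pq ≫ (A.iso m m' pq).hom =
    (topIso r A m m' pq hm h0 h).hom := by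
  refine homology_hom_ext _ (shape_next m pq) _ _ fun x => ?_
  refine (congrArg (A.iso m m' pq).hom.hom (homologyMap_cycleClass
    ((lowMinus r m).app (A.page m)) (shape_next m pq) x (map_mem_ker _ x.2))).trans ?_
  exact (topIso_apply r A m m' pq hm h0 h x).symm

lemma char_cycFst_eq_char_cycSnd (r : ℕ) (A : SpSe.{u, v} R) (m m' : ℤ) (pq : ℤ × ℤ)
    (hm : m + 1 = m') (h0 : 0 ≤ m) (h : m = r)
    (a : lowCycles r (A.page m) pq (pq + (-m, 1 - m))) :
    charMap A m m' hm h0 (shape_next m pq) (cycSnd r _ _ _ a) =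
      charMap A m m' hm h0 (shape_next m pq) (cycFst r _ _ _ a) := by
  obtain ⟨w, hw⟩ := (conn_bijective r h (A.page m h0).X (shape_prev m pq)).2 a.1.2.1
  have ha := congrArg (fun t => t.2.1) a.2
  change pathSign r m • ((A.page m h0).d (pq + pathShift r) _).hom a.1.2.1 +
    (conn r m (A.page m h0).X _ _).hom (a.1.2.2 - a.1.1) = 0 at ha
  have hs : pathSign r m = -1 := by rw [h, pathSign_self]
  rw [← sub_eq_zero, ← map_sub, char_eq_zero_iff A m m' hm h0 (shape_prev m pq)]
  refine ⟨w, ?_⟩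
  apply (conn_bijective r h (A.page m h0).X (shape_next m pq)).1
  rw [← ModuleCat.comp_apply]
  erw [conn_comp_d r (A.page m h0) (shape_prev m pq) (shape_next m pq)]
  rw [ModuleCat.comp_apply, hw]
  rw [hs, neg_one_zsmul, neg_add_eq_zero] at ha
  exact ha

lemma topIso_plus (r : ℕ) (A : SpSe.{u, v} R) (m m' : ℤ) (pq : ℤ × ℤ)
    (hm : m + 1 = m') (h0 : 0 ≤ m) (h : m = r) :
    HomologicalComplex.homologyMap ((lowPlus r m).app (A.page m)) pq ≫ (A.iso m m' pq).hom =
    (topIso r A m m' pq hm h0 h).hom := by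
  refine homology_hom_ext _ (shape_next m pq) _ _ fun x => ?_
  refine (congrArg (A.iso m m' pq).hom.hom (homologyMap_cycleClass
    ((lowPlus r m).app (A.page m)) (shape_next m pq) x (map_mem_ker _ x.2))).trans ?_
  refine Eq.trans ?_ (topIso_apply r A m m' pq hm h0 h x).symm
  exact char_cycFst_eq_char_cycSnd r A m m' pq hm h0 h x

/-- The page `m` of the `r`-path, as a functor of the page `m` of the given spectral sequence:
`lowPath` if `m ≤ r` and the identity if `m > r`. -/
noncomputable def pathPage (r : ℕ) (m : ℤ) :
    BigradedComplex.{u, v} R m ⥤ BigradedComplex.{u, v} R m :=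
  if m ≤ r then lowPathFunctor r m else 𝟭 _

/-- The identification of the pages `m ≤ r` of the `r`-path. -/
noncomputable def pathPageLow (r : ℕ) (m : ℤ) (h : m ≤ r) :
    pathPage.{u, v} (R := R) r m ≅ lowPathFunctor r m := eqToIso (if_pos h)

/-- The identification of the pages `m > r` of the `r`-path. -/
noncomputable def pathPageHigh (r : ℕ) (m : ℤ) (h : ¬ m ≤ r) :
    pathPage.{u, v} (R := R) r m ≅ 𝟭 _ := eqToIso (if_neg h)

/-- Auxiliary: transport an isomorphism `H(L) ≅ N.X` along `K ≅ L` and `M ≅ N`. -/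
noncomputable def conjIso {m m' : ℤ} {K L : BigradedComplex.{u, v} R m}
    {M N : BigradedComplex.{u, v} R m'} (α : K ≅ L) (β : M ≅ N) (pq : ℤ × ℤ)
    (e : L.homology pq ≅ N.X pq) : K.homology pq ≅ M.X pq :=
  HomologicalComplex.homologyMapIso α pq ≪≫ e ≪≫
    (HomologicalComplex.eval _ (shape m') pq).mapIso β.symm

lemma conjIso_comm {m m' : ℤ} {K₁ L₁ K₂ L₂ : BigradedComplex.{u, v} R m}
    {M₁ N₁ M₂ N₂ : BigradedComplex.{u, v} R m'} (α₁ : K₁ ≅ L₁) (β₁ : M₁ ≅ N₁) (α₂ : K₂ ≅ L₂)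
    (β₂ : M₂ ≅ N₂) (pq : ℤ × ℤ) (e₁ : L₁.homology pq ≅ N₁.X pq) (e₂ : L₂.homology pq ≅ N₂.X pq)
    (f : K₁ ⟶ K₂) (f' : L₁ ⟶ L₂) (g : M₁ ⟶ M₂) (g' : N₁ ⟶ N₂)
    (hf : f ≫ α₂.hom = α₁.hom ≫ f') (hg : g ≫ β₂.hom = β₁.hom ≫ g')
    (h : HomologicalComplex.homologyMap f' pq ≫ e₂.hom = e₁.hom ≫ g'.f pq) :
    HomologicalComplex.homologyMap f pq ≫ (conjIso α₂ β₂ pq e₂).hom =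
      (conjIso α₁ β₁ pq e₁).hom ≫ g.f pq := by
  have hg' : β₁.inv.f pq ≫ g.f pq = g'.f pq ≫ β₂.inv.f pq := by
    rw [← HomologicalComplex.comp_f, ← HomologicalComplex.comp_f]
    congr 1
    rw [Iso.inv_comp_eq, ← Category.assoc, ← hg, Category.assoc, Iso.hom_inv_id, Category.comp_id]
  change HomologicalComplex.homologyMap f pq ≫ HomologicalComplex.homologyMap α₂.hom pq ≫
    e₂.hom ≫ β₂.inv.f pq =
    (HomologicalComplex.homologyMap α₁.hom pq ≫ e₁.hom ≫ β₁.inv.f pq) ≫ g.f pq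
  rw [← Category.assoc, ← HomologicalComplex.homologyMap_comp, hf,
    HomologicalComplex.homologyMap_comp, Category.assoc, Category.assoc, Category.assoc, hg',
    ← Category.assoc (HomologicalComplex.homologyMap f' pq), h, Category.assoc]

/-- The characteristic maps of the `r`-path. -/
noncomputable def pathIso (r : ℕ) (A : SpSe.{u, v} R) (m m' : ℤ) (pq : ℤ × ℤ) (hm : m + 1 = m')
    (h0 : 0 ≤ m) :
    ((pathPage r m).obj (A.page m)).homology pq ≅ ((pathPage r m').obj (A.page m')).X pq :=
  if h : m' ≤ r then
    conjIso ((pathPageLow r m (by lia)).app _) ((pathPageLow r m' h).app _) pq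
      (lowIso r A m m' pq hm h0 (by lia))
  else if h' : m = r then
    conjIso ((pathPageLow r m (by lia)).app _) ((pathPageHigh r m' h).app _) pq
      (topIso r A m m' pq hm h0 h')
  else
    conjIso ((pathPageHigh r m (by lia)).app _) ((pathPageHigh r m' h).app _) pq
      (A.iso m m' pq)

lemma pathIso_natural (r : ℕ) {A B : SpSe.{u, v} R} (f : A ⟶ B) (m m' : ℤ) (pq : ℤ × ℤ)
    (hm : m + 1 = m') (h0 : 0 ≤ m) :
    HomologicalComplex.homologyMap ((pathPage r m).map (f.hom m)) pq ≫
      (pathIso r B m m' pq hm h0).hom =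
    (pathIso r A m m' pq hm h0).hom ≫ ((pathPage r m').map (f.hom m')).f pq := by
  unfold pathIso
  split_ifs with h h'
  · exact conjIso_comm _ _ _ _ _ _ _ _ _ _ _ ((pathPageLow r m (by lia)).hom.naturality _)
      ((pathPageLow r m' h).hom.naturality _) (lowIso_natural r f m m' pq hm h0 _)
  · exact conjIso_comm _ _ _ _ _ _ _ _ _ _ _ ((pathPageLow r m (by lia)).hom.naturality _)
      ((pathPageHigh r m' h).hom.naturality _) (topIso_natural r f m m' pq hm h0 _)
  · exact conjIso_comm _ _ _ _ _ _ _ _ _ _ _ ((pathPageHigh r m (by lia)).hom.naturality _)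
      ((pathPageHigh r m' h).hom.naturality _) (f.comm m m' pq)

/-- The `r`-path functor `P(r; -)` on spectral sequences. -/
noncomputable def pathSpSe (r : ℕ) : SpSe.{u, v} R ⥤ SpSe.{u, v} R where
  obj A :=
    { page := fun m _ => (pathPage r m).obj (A.page m)
      iso := fun m m' pq hm h0 => pathIso r A m m' pq hm h0 }
  map f :=
    { hom := fun m _ => (pathPage r m).map (f.hom m)
      comm := fun m m' pq hm h0 => pathIso_natural r f m m' pq hm h0 }
  map_id A := by
    ext1 m hm
    exact (pathPage r m).map_id _
  map_comp f g := by
    ext1 m hm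
    exact (pathPage r m).map_comp _ _

/-- The map `ι` on the page `m`: `x ↦ (x, 0, x)` if `m ≤ r`, the identity if `m > r`. -/
noncomputable def pathPageι (r : ℕ) (m : ℤ) : 𝟭 (BigradedComplex.{u, v} R m) ⟶ pathPage r m :=
  if h : m ≤ r then lowι r m ≫ (pathPageLow r m h).inv else (pathPageHigh r m h).inv

/-- The map `∂⁻` on the page `m`: `(x, y, z) ↦ x` if `m ≤ r`, the identity if `m > r`. -/
noncomputable def pathPageMinus (r : ℕ) (m : ℤ) :
    pathPage r m ⟶ 𝟭 (BigradedComplex.{u, v} R m) :=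
  if h : m ≤ r then (pathPageLow r m h).hom ≫ lowMinus r m else (pathPageHigh r m h).hom

/-- The map `∂⁺` on the page `m`: `(x, y, z) ↦ z` if `m ≤ r`, the identity if `m > r`. -/
noncomputable def pathPagePlus (r : ℕ) (m : ℤ) :
    pathPage r m ⟶ 𝟭 (BigradedComplex.{u, v} R m) :=
  if h : m ≤ r then (pathPageLow r m h).hom ≫ lowPlus r m else (pathPageHigh r m h).hom

lemma iso_eq_conjIso (A : SpSe.{u, v} R) (m m' : ℤ) (pq : ℤ × ℤ) (hm : m + 1 = m') (h0 : 0 ≤ m) :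
    A.iso m m' pq = conjIso (Iso.refl _) (Iso.refl _) pq (A.iso m m' pq) := by
  ext1
  change _ = HomologicalComplex.homologyMap (𝟙 _) pq ≫ (A.iso m m' pq).hom ≫ 𝟙 _
  rw [HomologicalComplex.homologyMap_id, Category.id_comp, Category.comp_id]

lemma pathIso_low (r : ℕ) (A : SpSe.{u, v} R) (m m' : ℤ) (pq : ℤ × ℤ) (hm : m + 1 = m')
    (h0 : 0 ≤ m) (h : m' ≤ r) (h1 : m ≤ r) (h2 : m ≠ r) :
    pathIso r A m m' pq hm h0 = conjIso ((pathPageLow r m h1).app _) ((pathPageLow r m' h).app _) pq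
      (lowIso r A m m' pq hm h0 h2) := dif_pos h

lemma pathIso_top (r : ℕ) (A : SpSe.{u, v} R) (m m' : ℤ) (pq : ℤ × ℤ) (hm : m + 1 = m')
    (h0 : 0 ≤ m) (h : ¬ m' ≤ r) (h1 : m ≤ r) (h2 : m = r) :
    pathIso r A m m' pq hm h0 = conjIso ((pathPageLow r m h1).app _) ((pathPageHigh r m' h).app _) pq
      (topIso r A m m' pq hm h0 h2) := (dif_neg h).trans (dif_pos h2)

lemma pathIso_high (r : ℕ) (A : SpSe.{u, v} R) (m m' : ℤ) (pq : ℤ × ℤ) (hm : m + 1 = m')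
    (h0 : 0 ≤ m) (h : ¬ m' ≤ r) (h1 : ¬ m ≤ r) (h2 : m ≠ r) :
    pathIso r A m m' pq hm h0 = conjIso ((pathPageHigh r m h1).app _)
      ((pathPageHigh r m' h).app _) pq (A.iso m m' pq) := (dif_neg h).trans (dif_neg h2)

lemma side_in {C : Type*} [Category C] {F G : C ⥤ C} (α : F ≅ G) (t : 𝟭 C ⟶ G) (K : C) :
    (t ≫ α.inv).app K ≫ (α.app K).hom = (Iso.refl K).hom ≫ t.app K := by
  rw [NatTrans.comp_app, Category.assoc, Iso.app_hom, Iso.inv_hom_id_app, Iso.refl_hom,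
    Category.comp_id]
  exact (Category.id_comp _).symm

lemma side_out {C : Type*} [Category C] {F G : C ⥤ C} (α : F ≅ G) (t : G ⟶ 𝟭 C) (K : C) :
    (α.hom ≫ t).app K ≫ (Iso.refl K).hom = (α.app K).hom ≫ t.app K := by
  rw [NatTrans.comp_app, Iso.app_hom, Iso.refl_hom]
  exact Category.comp_id _

lemma id_comm (A : SpSe.{u, v} R) (m m' : ℤ) (pq : ℤ × ℤ) (hm : m + 1 = m') (h0 : 0 ≤ m) :
    HomologicalComplex.homologyMap (𝟙 (A.page m)) pq ≫ (A.iso m m' pq).hom =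
      (A.iso m m' pq).hom ≫ (𝟙 (A.page m') : A.page m' ⟶ A.page m').f pq := by
  rw [HomologicalComplex.homologyMap_id, Category.id_comp]
  exact (Category.comp_id _).symm

lemma pathPageι_low (r : ℕ) (m : ℤ) (h : m ≤ r) :
    pathPageι.{u, v} (R := R) r m = lowι r m ≫ (pathPageLow r m h).inv := dif_pos h

lemma pathPageι_high (r : ℕ) (m : ℤ) (h : ¬ m ≤ r) :
    pathPageι.{u, v} (R := R) r m = 𝟙 _ ≫ (pathPageHigh r m h).inv :=
  (dif_neg h).trans (Category.id_comp _).symm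

lemma pathPageι_comm (r : ℕ) (A : SpSe.{u, v} R) (m m' : ℤ) (pq : ℤ × ℤ) (hm : m + 1 = m')
    (h0 : 0 ≤ m) :
    HomologicalComplex.homologyMap ((pathPageι r m).app (A.page m)) pq ≫ (pathIso r A m m' pq hm h0).hom =
      (A.iso m m' pq).hom ≫ ((pathPageι r m').app (A.page m')).f pq := by
  rw [iso_eq_conjIso A m m' pq hm h0]
  by_cases h : m' ≤ r
  · have h1 : m ≤ r := by lia
    have h2 : m ≠ r := by lia
    rw [pathIso_low r A m m' pq hm h0 h h1 h2, pathPageι_low r m h1, pathPageι_low r m' h]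
    exact conjIso_comm _ _ _ _ _ _ _ _ ((lowι r m).app _) _ ((lowι r m').app _)
      (side_in _ _ _) (side_in _ _ _) (lowIso_ι r A m m' pq hm h0 h2)
  by_cases h2 : m = r
  · have h1 : m ≤ r := by lia
    rw [pathIso_top r A m m' pq hm h0 h h1 h2, pathPageι_low r m h1, pathPageι_high r m' h]
    exact conjIso_comm _ _ _ _ _ _ _ _ ((lowι r m).app _) _ (𝟙 _)
      (side_in _ _ _) (side_in _ _ _)
      ((topIso_ι r A m m' pq hm h0 h2).trans (Category.comp_id _).symm)
  · have h1 : ¬ m ≤ r := by lia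
    rw [pathIso_high r A m m' pq hm h0 h h1 h2, pathPageι_high r m h1, pathPageι_high r m' h]
    exact conjIso_comm _ _ _ _ _ _ _ _ (𝟙 _) _ (𝟙 _)
      (side_in _ _ _) (side_in _ _ _) (id_comm A m m' pq hm h0)

lemma pathPageMinus_low (r : ℕ) (m : ℤ) (h : m ≤ r) :
    pathPageMinus.{u, v} (R := R) r m = (pathPageLow r m h).hom ≫ lowMinus r m := dif_pos h

lemma pathPageMinus_high (r : ℕ) (m : ℤ) (h : ¬ m ≤ r) :
    pathPageMinus.{u, v} (R := R) r m = (pathPageHigh r m h).hom ≫ 𝟙 _ :=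
  (dif_neg h).trans (Category.comp_id _).symm

lemma pathPageMinus_comm (r : ℕ) (A : SpSe.{u, v} R) (m m' : ℤ) (pq : ℤ × ℤ) (hm : m + 1 = m')
    (h0 : 0 ≤ m) :
    HomologicalComplex.homologyMap ((pathPageMinus r m).app (A.page m)) pq ≫ (A.iso m m' pq).hom =
      (pathIso r A m m' pq hm h0).hom ≫ ((pathPageMinus r m').app (A.page m')).f pq := by
  rw [iso_eq_conjIso A m m' pq hm h0]
  by_cases h : m' ≤ r
  · have h1 : m ≤ r := by lia
    have h2 : m ≠ r := by lia
    rw [pathIso_low r A m m' pq hm h0 h h1 h2, pathPageMinus_low r m h1, pathPageMinus_low r m' h]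
    exact conjIso_comm _ _ _ _ _ _ _ _ ((lowMinus r m).app _) _ ((lowMinus r m').app _)
      (side_out _ _ _) (side_out _ _ _) (lowIso_minus r A m m' pq hm h0 h2)
  by_cases h2 : m = r
  · have h1 : m ≤ r := by lia
    rw [pathIso_top r A m m' pq hm h0 h h1 h2, pathPageMinus_low r m h1, pathPageMinus_high r m' h]
    exact conjIso_comm _ _ _ _ _ _ _ _ ((lowMinus r m).app _) _ (𝟙 _)
      (side_out _ _ _) (side_out _ _ _)
      ((topIso_minus r A m m' pq hm h0 h2).trans (Category.comp_id _).symm)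
  · have h1 : ¬ m ≤ r := by lia
    rw [pathIso_high r A m m' pq hm h0 h h1 h2, pathPageMinus_high r m h1, pathPageMinus_high r m' h]
    exact conjIso_comm _ _ _ _ _ _ _ _ (𝟙 _) _ (𝟙 _)
      (side_out _ _ _) (side_out _ _ _) (id_comm A m m' pq hm h0)

lemma pathPagePlus_low (r : ℕ) (m : ℤ) (h : m ≤ r) :
    pathPagePlus.{u, v} (R := R) r m = (pathPageLow r m h).hom ≫ lowPlus r m := dif_pos h

lemma pathPagePlus_high (r : ℕ) (m : ℤ) (h : ¬ m ≤ r) :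
    pathPagePlus.{u, v} (R := R) r m = (pathPageHigh r m h).hom ≫ 𝟙 _ :=
  (dif_neg h).trans (Category.comp_id _).symm

lemma pathPagePlus_comm (r : ℕ) (A : SpSe.{u, v} R) (m m' : ℤ) (pq : ℤ × ℤ) (hm : m + 1 = m')
    (h0 : 0 ≤ m) :
    HomologicalComplex.homologyMap ((pathPagePlus r m).app (A.page m)) pq ≫ (A.iso m m' pq).hom =
      (pathIso r A m m' pq hm h0).hom ≫ ((pathPagePlus r m').app (A.page m')).f pq := by
  rw [iso_eq_conjIso A m m' pq hm h0]
  by_cases h : m' ≤ r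
  · have h1 : m ≤ r := by lia
    have h2 : m ≠ r := by lia
    rw [pathIso_low r A m m' pq hm h0 h h1 h2, pathPagePlus_low r m h1, pathPagePlus_low r m' h]
    exact conjIso_comm _ _ _ _ _ _ _ _ ((lowPlus r m).app _) _ ((lowPlus r m').app _)
      (side_out _ _ _) (side_out _ _ _) (lowIso_plus r A m m' pq hm h0 h2)
  by_cases h2 : m = r
  · have h1 : m ≤ r := by lia
    rw [pathIso_top r A m m' pq hm h0 h h1 h2, pathPagePlus_low r m h1, pathPagePlus_high r m' h]
    exact conjIso_comm _ _ _ _ _ _ _ _ ((lowPlus r m).app _) _ (𝟙 _)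
      (side_out _ _ _) (side_out _ _ _)
      ((topIso_plus r A m m' pq hm h0 h2).trans (Category.comp_id _).symm)
  · have h1 : ¬ m ≤ r := by lia
    rw [pathIso_high r A m m' pq hm h0 h h1 h2, pathPagePlus_high r m h1, pathPagePlus_high r m' h]
    exact conjIso_comm _ _ _ _ _ _ _ _ (𝟙 _) _ (𝟙 _)
      (side_out _ _ _) (side_out _ _ _) (id_comm A m m' pq hm h0)

/-- The natural map `ι_A : A ⟶ P(r; A)`. -/
noncomputable def ιSpSe (r : ℕ) : 𝟭 (SpSe.{u, v} R) ⟶ pathSpSe r where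
  app A :=
    { hom := fun m _ => (pathPageι r m).app (A.page m)
      comm := fun m m' pq hm h0 => pathPageι_comm r A m m' pq hm h0 }
  naturality A B f := by
    ext1 m hm
    exact (pathPageι r m).naturality (f.hom m)

/-- The natural map `∂⁻_A : P(r; A) ⟶ A`. -/
noncomputable def minusSpSe (r : ℕ) : pathSpSe r ⟶ 𝟭 (SpSe.{u, v} R) where
  app A :=
    { hom := fun m _ => (pathPageMinus r m).app (A.page m)
      comm := fun m m' pq hm h0 => pathPageMinus_comm r A m m' pq hm h0 }
  naturality A B f := by
    ext1 m hm
    exact (pathPageMinus r m).naturality (f.hom m)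

/-- The natural map `∂⁺_A : P(r; A) ⟶ A`. -/
noncomputable def plusSpSe (r : ℕ) : pathSpSe r ⟶ 𝟭 (SpSe.{u, v} R) where
  app A :=
    { hom := fun m _ => (pathPagePlus r m).app (A.page m)
      comm := fun m m' pq hm h0 => pathPagePlus_comm r A m m' pq hm h0 }
  naturality A B f := by
    ext1 m hm
    exact (pathPagePlus r m).naturality (f.hom m)

end SpectralSequences

section Filtered
variable (R : Type u) [CommRing R]

/-- A filtered complex: a cochain complex of `R`-modules with an increasing filtration
`F_p K^n` by subcomplexes, indexed by `p : ℤ`. -/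
structure FilteredComplex where
  /-- the underlying (unbounded) cochain complex -/
  K : CochainComplex (ModuleCat.{v} R) ℤ
  /-- the filtration -/
  F (p n : ℤ) : Submodule R (K.X n)
  mono (p n : ℤ) : F (p - 1) n ≤ F p n
  d_mem (p n : ℤ) (x : K.X n) : x ∈ F p n → (K.d n (n + 1)).hom x ∈ F p (n + 1)

variable {R}

namespace FilteredComplex

/-- A morphism of filtered complexes: a morphism of complexes compatible with the filtrations. -/
@[ext]
structure Hom (A B : FilteredComplex.{u, v} R) where
  f : A.K ⟶ B.K
  map_mem (p n : ℤ) (x : A.K.X n) : x ∈ A.F p n → (f.f n).hom x ∈ B.F p n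

instance : Category (FilteredComplex.{u, v} R) where
  Hom := Hom
  id A := { f := 𝟙 A.K, map_mem := fun _ _ _ h => h }
  comp f g := { f := f.f ≫ g.f, map_mem := fun p n x h => g.map_mem p n _ (f.map_mem p n x h) }
  id_comp f := Hom.ext (Category.id_comp f.f)
  comp_id f := Hom.ext (Category.comp_id f.f)
  assoc f g h := Hom.ext (Category.assoc f.f g.f h.f)

variable (A : FilteredComplex.{u, v} R)

/-- The `m`-cycles `Z_m^p = F_p A^n ∩ d⁻¹ (F_{p-m} A^{n+1})`. -/
def Z (m p n : ℤ) : Submodule R (A.K.X n) :=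
  A.F p n ⊓ (A.F (p - m) (n + 1)).comap (A.K.d n (n + 1)).hom

/-- The `m`-boundaries `B_m^p = Z_{m-1}^{p-1} + d Z_{m-1}^{p+m-1}`. For `m = 0` this is
`Z_0^{p-1} = F_{p-1} A^n`, see `B_zero`. -/
def B (m p n : ℤ) : Submodule R (A.K.X n) :=
  A.Z (m - 1) (p - 1) n ⊔ (A.Z (m - 1) (p + m - 1) (n - 1)).map (A.K.d (n - 1) n).hom

variable {A}

lemma F_mono {p p' n : ℤ} (h : p ≤ p') : A.F p n ≤ A.F p' n := by
  obtain ⟨k, rfl⟩ := Int.le.dest h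
  induction k with
  | zero => simp
  | succ k ih =>
    refine (ih (by lia)).trans ?_
    have := A.mono (p + (k + 1 : ℕ)) n
    rwa [show p + ((k + 1 : ℕ) : ℤ) - 1 = p + k by push_cast; ring] at this

lemma d_d {a b c : ℤ} (x : A.K.X a) : (A.K.d b c).hom ((A.K.d a b).hom x) = 0 := by
  rw [← ModuleCat.comp_apply, A.K.d_comp_d]; rfl

lemma mem_Z {m p n n' p' : ℤ} (hn : n + 1 = n') (hp : p' = p - m) {x : A.K.X n} :
    x ∈ A.Z m p n ↔ x ∈ A.F p n ∧ (A.K.d n n').hom x ∈ A.F p' n' := by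
  subst hn hp; rfl

lemma mem_B {m p n n' a b c : ℤ} (hn : n' + 1 = n) (ha : a = m - 1) (hb : b = p - 1)
    (hc : c = p + m - 1) {x : A.K.X n} :
    x ∈ A.B m p n ↔ ∃ y ∈ A.Z a b n, ∃ z ∈ A.Z a c n', y + (A.K.d n' n).hom z = x := by
  obtain rfl : n' = n - 1 := by lia
  subst ha hb hc
  unfold B
  simp only [Submodule.mem_sup, Submodule.mem_map, exists_exists_and_eq_and]

lemma d_mem' {p n n' : ℤ} (hn : n + 1 = n') {x : A.K.X n} (hx : x ∈ A.F p n) :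
    (A.K.d n n').hom x ∈ A.F p n' := by
  subst hn; exact A.d_mem p n x hx

lemma Z_of_F {m p q n : ℤ} {x : A.K.X n} (hx : x ∈ A.F q n) (h : q ≤ p) (h' : q ≤ p - m) :
    x ∈ A.Z m p n :=
  ⟨F_mono h hx, F_mono h' (A.d_mem q n x hx)⟩

lemma B_zero (p n : ℤ) : A.B 0 p n = A.Z 0 (p - 1) n := by
  ext x
  rw [mem_B (n' := n - 1) (by lia) rfl rfl rfl, mem_Z rfl rfl]
  constructor
  · rintro ⟨y, hy, z, hz, rfl⟩
    have h1 := (mem_Z rfl rfl).1 hy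
    have h2 := (mem_Z (n' := n) (by lia) rfl).1 hz
    have h3 : y + (A.K.d (n - 1) n).hom z ∈ A.F (p - 1) n :=
      add_mem h1.1 (d_mem' (by lia) (F_mono (by lia) h2.1))
    exact ⟨h3, F_mono (by lia) (A.d_mem _ _ _ h3)⟩
  · rintro ⟨h1, h2⟩
    exact ⟨x, Z_of_F h1 (by lia) (by lia), 0, zero_mem _, by rw [map_zero, add_zero]⟩

lemma B_le_Z {m p n : ℤ} (_hm : 0 ≤ m) : A.B m p n ≤ A.Z m p n := by
  intro x hx
  obtain ⟨y, hy, z, hz, rfl⟩ := (mem_B (n' := n - 1) (by lia) rfl rfl rfl).1 hx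
  have h1 := (mem_Z rfl rfl).1 hy
  have h2 := (mem_Z (n' := n) (by lia) rfl).1 hz
  refine (mem_Z rfl rfl).2 ⟨add_mem (F_mono (by lia) h1.1) (F_mono (by lia) h2.2), ?_⟩
  rw [map_add, d_d, add_zero]
  exact F_mono (by lia) h1.2

lemma d_Z {m p p' n n' : ℤ} (hn : n + 1 = n') (hp : p' = p - m) {x : A.K.X n}
    (hx : x ∈ A.Z m p n) : (A.K.d n n').hom x ∈ A.Z m p' n' := by
  refine (mem_Z rfl rfl).2 ⟨((mem_Z hn hp).1 hx).2, ?_⟩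
  rw [d_d]
  exact zero_mem _

lemma d_B {m p p' n n' : ℤ} (hn : n + 1 = n') (hp : p' = p - m) {x : A.K.X n}
    (hx : x ∈ A.B m p n) : (A.K.d n n').hom x ∈ A.B m p' n' := by
  obtain ⟨y, hy, z, hz, rfl⟩ := (mem_B (n' := n - 1) (by lia) rfl rfl rfl).1 hx
  refine (mem_B hn rfl rfl rfl).2 ⟨0, zero_mem _, y, ?_, ?_⟩
  · rwa [show p' + m - 1 = p - 1 by lia]
  · rw [map_add, d_d, add_zero, zero_add]

variable (A)

/-- The bigraded module `E_m^{p,q} = Z_m^{p,q} / B_m^{p,q}` in bidegree `i = (p, q)`; the degree in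
the complex is `n = q - p`. -/
abbrev E (m : ℤ) (i : ℤ × ℤ) : Type v :=
  A.Z m i.1 (i.2 - i.1) ⧸ (A.B m i.1 (i.2 - i.1)).submoduleOf (A.Z m i.1 (i.2 - i.1))

/-- The class in `E_m^{p,q}` of an element of `Z_m^{p,q}`. -/
abbrev cls (m : ℤ) (i : ℤ × ℤ) : A.Z m i.1 (i.2 - i.1) →ₗ[R] A.E m i := Submodule.mkQ _

variable {A}

lemma cls_eq_zero {m : ℤ} {i : ℤ × ℤ} {x : A.Z m i.1 (i.2 - i.1)} :
    A.cls m i x = 0 ↔ x.1 ∈ A.B m i.1 (i.2 - i.1) :=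
  Submodule.Quotient.mk_eq_zero _

lemma rel_deg {m : ℤ} {i j : ℤ × ℤ} (h : (shape m).Rel i j) :
    i.2 - i.1 + 1 = j.2 - j.1 ∧ j.1 = i.1 - m := by
  obtain rfl : i + (-m, 1 - m) = j := h
  simp only [Prod.fst_add, Prod.snd_add]
  exact ⟨by lia, by lia⟩

variable (A)

/-- The differential of the page `m`, `δ_m [a] = [d a]`. -/
noncomputable def δ (m : ℤ) {i j : ℤ × ℤ} (h : (shape m).Rel i j) : A.E m i →ₗ[R] A.E m j :=
  Submodule.mapQ _ _
    ((A.K.d (i.2 - i.1) (j.2 - j.1)).hom.restrict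
      (fun _ hx => d_Z (rel_deg h).1 (rel_deg h).2 hx))
    (fun _ hx => d_B (rel_deg h).1 (rel_deg h).2 hx)

lemma δ_cls (m : ℤ) {i j : ℤ × ℤ} (h : (shape m).Rel i j) (x : A.Z m i.1 (i.2 - i.1)) :
    A.δ m h (A.cls m i x) =
      A.cls m j ⟨(A.K.d _ _).hom x.1, d_Z (rel_deg h).1 (rel_deg h).2 x.2⟩ := rfl

open Classical in
/-- The page `m` of the spectral sequence of a filtered complex. -/
noncomputable def page (m : ℤ) : BigradedComplex.{u, v} R m where
  X i := ModuleCat.of R (A.E m i)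
  d i j := if h : (shape m).Rel i j then ModuleCat.ofHom (A.δ m h) else 0
  shape i j h := dif_neg h
  d_comp_d' i j k hij hjk := by
    rw [dif_pos hij, dif_pos hjk]
    refine ModuleCat.hom_ext (LinearMap.ext fun w => ?_)
    obtain ⟨x, rfl⟩ := Submodule.mkQ_surjective _ w
    change A.cls m k ⟨(A.K.d _ _).hom ((A.K.d _ _).hom x.1), _⟩ = 0
    rw [cls_eq_zero]
    change (A.K.d _ _).hom ((A.K.d _ _).hom x.1) ∈ _
    rw [d_d]
    exact zero_mem _

lemma page_d (m : ℤ) {i j : ℤ × ℤ} (h : (shape m).Rel i j) :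
    ((A.page m).d i j).hom = A.δ m h := by
  change (dite _ _ _ : ModuleCat.of R (A.E m i) ⟶ ModuleCat.of R (A.E m j)).hom = _
  rw [dif_pos h]
  rfl

variable {A} in
lemma page_d_cls_eq_zero {m : ℤ} {i j : ℤ × ℤ} (h : (shape m).Rel i j)
    (x : A.Z m i.1 (i.2 - i.1)) : ((A.page m).d i j).hom (A.cls m i x) = 0 ↔
      (A.K.d (i.2 - i.1) (j.2 - j.1)).hom x.1 ∈ A.B m j.1 (j.2 - j.1) := by
  rw [page_d A m h]
  exact cls_eq_zero

variable {A} in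
lemma Z_succ_le {m p n : ℤ} : A.Z (m + 1) p n ≤ A.Z m p n :=
  fun _ hx => ⟨hx.1, F_mono (by lia) hx.2⟩

variable {A} in
lemma d_Z_succ_mem_B {m p p' n n' : ℤ} (hn : n + 1 = n') (hp : p' = p - m) {x : A.K.X n}
    (hx : x ∈ A.Z (m + 1) p n) : (A.K.d n n').hom x ∈ A.B m p' n' := by
  refine (mem_B hn rfl rfl rfl).2 ⟨_, ?_, 0, zero_mem _, by rw [map_zero, add_zero]⟩
  refine (mem_Z rfl rfl).2 ⟨((mem_Z hn (by lia)).1 hx).2, ?_⟩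
  rw [d_d]
  exact zero_mem _

/-- The isomorphism `H(E_m) ≅ E_{m+1}`: it sends the class of `[a]_m` to `[a]_{m+1}`, for
`a ∈ Z_{m+1}`. -/
noncomputable def pageIso (m m' : ℤ) (i : ℤ × ℤ) (hm : m + 1 = m') (_h0 : 0 ≤ m) :
    (A.page m).homology i ≅ (A.page m').X i :=
  homologyIso (A.page m) (shape_prev m i) (shape_next m i)
    (Z := A.Z m' i.1 (i.2 - i.1))
    (A.cls m i ∘ₗ Submodule.inclusion (by subst hm; exact Z_succ_le))
    (A.cls m' i)
    (fun a => by
      subst hm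
      refine (page_d_cls_eq_zero (shape_next m i) _).2 ?_
      exact d_Z_succ_mem_B (rel_deg (shape_next m i)).1 (rel_deg (shape_next m i)).2 a.2)
    (Submodule.mkQ_surjective _)
    (fun x hx => by
      subst hm
      obtain ⟨x, rfl⟩ := Submodule.mkQ_surjective _ x
      have hr := rel_deg (shape_next m i)
      have h1 := (page_d_cls_eq_zero (shape_next m i) x).1 hx
      obtain ⟨b, hb, c, hc, hbc⟩ := (mem_B hr.1 rfl rfl rfl).1 h1
      have hx2 := (mem_Z hr.1 hr.2).1 x.2
      have hb2 := (mem_Z rfl rfl).1 hb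
      have hc2 := (mem_Z hr.1 rfl).1 hc
      refine ⟨⟨x.1 - c, (mem_Z hr.1 rfl).2
        ⟨sub_mem hx2.1 (F_mono (by lia) hc2.1), ?_⟩⟩, 0, ?_⟩
      · rw [map_sub, ← hbc, add_sub_cancel_right]
        exact F_mono (by lia) hb2.1
      · rw [map_zero, eq_comm]
        refine ((A.cls m i).map_sub _ _).symm.trans (cls_eq_zero.2 ?_)
        change x.1 - (x.1 - c) ∈ _
        rw [sub_sub_cancel]
        refine (mem_B (n' := i.2 - i.1 - 1) (by lia) rfl rfl rfl).2
          ⟨c, ?_, 0, zero_mem _, by rw [map_zero, add_zero]⟩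
        rwa [show i.1 - 1 = (i + (-m, 1 - m)).1 + m - 1 by lia])
    (fun a => by
      subst hm
      have hr := rel_deg (shape_prev m i)
      refine (cls_eq_zero (m := m + 1)).trans ?_
      rw [mem_B hr.1 (a := m) (c := (i - (-m, 1 - m)).1) (by lia) rfl (by lia)]
      constructor
      · rintro ⟨y, hy, z, hz, hyz⟩
        refine ⟨A.cls m _ ⟨z, hz⟩, ?_⟩
        rw [page_d A m (shape_prev m i), ← sub_eq_zero]
        refine ((A.cls m i).map_sub _ _).symm.trans (cls_eq_zero.2 ?_)
        change (A.K.d _ _).hom z - a.1 ∈ _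
        rw [← hyz, sub_add_cancel_right, neg_mem_iff]
        exact (mem_B hr.1 rfl rfl rfl).2 ⟨y, ⟨hy.1, F_mono (by lia) hy.2⟩, 0, zero_mem _,
          by rw [map_zero, add_zero]⟩
      · rintro ⟨y, hy⟩
        obtain ⟨y, rfl⟩ := Submodule.mkQ_surjective _ y
        rw [page_d A m (shape_prev m i), ← sub_eq_zero] at hy
        have h1 := cls_eq_zero.1 (((A.cls m i).map_sub _ _).trans hy)
        change (A.K.d _ _).hom y.1 - a.1 ∈ _ at h1
        obtain ⟨b, hb, c, hc, hbc⟩ := (mem_B hr.1 rfl rfl rfl).1 h1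
        have hb2 := (mem_Z rfl rfl).1 hb
        have ha2 := (mem_Z rfl rfl).1 a.2
        refine ⟨-b, neg_mem ((mem_Z rfl rfl).2 ⟨hb2.1, ?_⟩), y.1 - c,
          sub_mem y.2 ((mem_Z hr.1 rfl).2 ⟨?_, ?_⟩), ?_⟩
        · have h2 : (A.K.d (i.2 - i.1) (i.2 - i.1 + 1)).hom b =
              - (A.K.d (i.2 - i.1) (i.2 - i.1 + 1)).hom a.1 := by
            have h3 := congrArg (A.K.d (i.2 - i.1) (i.2 - i.1 + 1)).hom hbc
            rw [map_add, d_d, add_zero, map_sub, d_d, zero_sub] at h3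
            exact h3
          rw [h2]
          exact neg_mem (F_mono (by lia) ha2.2)
        · have h2 := ((mem_Z hr.1 rfl).1 hc).1
          exact F_mono (by lia) h2
        · have h2 := ((mem_Z hr.1 rfl).1 hc).2
          exact F_mono (by lia) h2
        · rw [map_sub, ← sub_eq_iff_eq_add'.2 hbc.symm]
          abel)

variable {A} in
lemma map_Z {B : FilteredComplex.{u, v} R} (f : A ⟶ B) {m p n : ℤ} {x : A.K.X n}
    (hx : x ∈ A.Z m p n) : (f.f.f n).hom x ∈ B.Z m p n := by
  refine ⟨f.map_mem _ _ _ hx.1, ?_⟩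
  change (B.K.d n (n + 1)).hom ((f.f.f n).hom x) ∈ B.F (p - m) (n + 1)
  rw [← ModuleCat.comp_apply, f.f.comm, ModuleCat.comp_apply]
  exact f.map_mem _ _ _ hx.2

variable {A} in
lemma map_B {B : FilteredComplex.{u, v} R} (f : A ⟶ B) {m p n : ℤ} {x : A.K.X n}
    (hx : x ∈ A.B m p n) : (f.f.f n).hom x ∈ B.B m p n := by
  obtain ⟨y, hy, z, hz, rfl⟩ := (mem_B (n' := n - 1) (by lia) rfl rfl rfl).1 hx
  refine (mem_B (n' := n - 1) (by lia) rfl rfl rfl).2 ⟨_, map_Z f hy, _, map_Z f hz, ?_⟩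
  rw [map_add, ← ModuleCat.comp_apply, f.f.comm, ModuleCat.comp_apply]

/-- The map induced on the pages: `[a] ↦ [f a]`. -/
noncomputable def mapE {A B : FilteredComplex.{u, v} R} (f : A ⟶ B) (m : ℤ) (i : ℤ × ℤ) :
    A.E m i →ₗ[R] B.E m i :=
  Submodule.mapQ _ _ ((f.f.f (i.2 - i.1)).hom.restrict (fun _ hx => map_Z f hx))
    (fun _ hx => map_B f hx)

/-- The morphism of `m`-bigraded complexes induced by a morphism of filtered complexes. -/
noncomputable def mapPage {A B : FilteredComplex.{u, v} R} (f : A ⟶ B) (m : ℤ) :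
    A.page m ⟶ B.page m where
  f i := ModuleCat.ofHom (mapE f m i)
  comm' i j h := by
    refine ModuleCat.hom_ext (LinearMap.ext fun w => ?_)
    obtain ⟨x, rfl⟩ := Submodule.mkQ_surjective _ w
    change ((B.page m).d i j).hom (mapE f m i (A.cls m i x)) =
      mapE f m j (((A.page m).d i j).hom (A.cls m i x))
    rw [page_d A m h, page_d B m h]
    refine congrArg (B.cls m j) (Subtype.ext ?_)
    change (B.K.d _ _).hom ((f.f.f _).hom x.1) = (f.f.f _).hom ((A.K.d _ _).hom x.1)
    rw [← ModuleCat.comp_apply, f.f.comm, ModuleCat.comp_apply]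

lemma pageIso_natural {A B : FilteredComplex.{u, v} R} (f : A ⟶ B) (m m' : ℤ) (i : ℤ × ℤ)
    (hm : m + 1 = m') (h0 : 0 ≤ m) :
    HomologicalComplex.homologyMap (mapPage f m) i ≫ (B.pageIso m m' i hm h0).hom =
      (A.pageIso m m' i hm h0).hom ≫ (mapPage f m').f i := by
  unfold pageIso
  exact homologyIso_natural (shape_prev m i) (shape_next m i) (mapPage f m) ((mapPage f m').f i)
    fun a => ⟨⟨_, map_Z f a.2⟩, rfl, rfl⟩

/-- The spectral sequence functor on filtered complexes. -/
noncomputable def spectralSequence : FilteredComplex.{u, v} R ⥤ SpSe.{u, v} R where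
  obj A :=
    { page := fun m _ => A.page m
      iso := fun m m' i hm h0 => A.pageIso m m' i hm h0 }
  map f :=
    { hom := fun m _ => mapPage f m
      comm := fun m m' i hm h0 => pageIso_natural f m m' i hm h0 }
  map_id A := by
    ext1 m hm
    refine HomologicalComplex.Hom.ext (funext fun i => ?_)
    refine ModuleCat.hom_ext (LinearMap.ext fun w => ?_)
    obtain ⟨x, rfl⟩ := Submodule.mkQ_surjective _ w
    rfl
  map_comp f g := by
    ext1 m hm
    refine HomologicalComplex.Hom.ext (funext fun i => ?_)
    refine ModuleCat.hom_ext (LinearMap.ext fun w => ?_)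
    obtain ⟨x, rfl⟩ := Submodule.mkQ_surjective _ w
    rfl

end FilteredComplex
end Filtered

section Multicomplexes
variable (R : Type u) [CommRing R]

/-- A multicomplex: a bigraded `R`-module `A` with maps `d_i`, `i ≥ 0`, of bidegree `(-i, 1 - i)`,
such that `∑_{i+j=l} (-1)^i d_i d_j = 0` for all `l ≥ 0`. The map `d i a b : A^a → A^b` is only
allowed to be nonzero if `b = a + (-i, 1 - i)`. -/
structure Multicomplex where
  /-- the bigraded module -/
  X : ℤ × ℤ → ModuleCat.{v} R
  /-- the structure maps -/
  d (i : ℕ) (a b : ℤ × ℤ) : X a ⟶ X b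
  d_shape (i : ℕ) (a b : ℤ × ℤ) : a + (-(i : ℤ), 1 - (i : ℤ)) ≠ b → d i a b = 0
  rel (l : ℕ) (a b : ℤ × ℤ) : ∑ ij ∈ Finset.HasAntidiagonal.antidiagonal l,
    (-1 : ℤ) ^ ij.1 •
      (d ij.2 a (a + (-(ij.2 : ℤ), 1 - (ij.2 : ℤ))) ≫
        d ij.1 (a + (-(ij.2 : ℤ), 1 - (ij.2 : ℤ))) b) = 0

variable {R}

namespace Multicomplex

/-- A strict morphism of multicomplexes: a map of bigraded modules commuting with all `d_i`. -/
@[ext]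
structure Hom (A B : Multicomplex.{u, v} R) where
  f (a : ℤ × ℤ) : A.X a ⟶ B.X a
  comm (i : ℕ) (a b : ℤ × ℤ) : f a ≫ B.d i a b = A.d i a b ≫ f b

instance : Category (Multicomplex.{u, v} R) where
  Hom := Hom
  id A := { f := fun _ => 𝟙 _, comm := by intros; simp }
  comp f g :=
    { f := fun a => f.f a ≫ g.f a
      comm := fun i a b => by
        rw [Category.assoc, g.comm, ← Category.assoc, f.comm, Category.assoc] }
  id_comp f := Hom.ext (funext fun a => Category.id_comp (f.f a))
  comp_id f := Hom.ext (funext fun a => Category.comp_id (f.f a))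
  assoc f g h := Hom.ext (funext fun a => Category.assoc (f.f a) (g.f a) (h.f a))

variable (A : Multicomplex.{u, v} R)

lemma d_hom_comm {A B : Multicomplex.{u, v} R} (f : A ⟶ B) (i : ℕ) (a b : ℤ × ℤ) (x : A.X a) :
    (B.d i a b).hom ((f.f a).hom x) = (f.f b).hom ((A.d i a b).hom x) := by
  rw [← ModuleCat.comp_apply, ← ModuleCat.comp_apply, f.comm]

/-- The defining relations, evaluated on elements. -/
lemma rel_apply (l : ℕ) (a c : ℤ × ℤ) (b : ℕ → ℤ × ℤ)
    (hb : ∀ j, b j = a + (-(j : ℤ), 1 - (j : ℤ))) (x : A.X a) :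
    ∑ ij ∈ Finset.HasAntidiagonal.antidiagonal l,
      (-1 : ℤ) ^ ij.1 • (A.d ij.1 (b ij.2) c).hom ((A.d ij.2 a (b ij.2)).hom x) = 0 := by
  obtain rfl : b = fun j : ℕ => a + (-(j : ℤ), 1 - (j : ℤ)) := funext hb
  have h := congrArg (fun t => t.hom x) (A.rel l a c)
  simp only [ModuleCat.hom_sum, LinearMap.sum_apply, ModuleCat.hom_zsmul, LinearMap.smul_apply,
    ModuleCat.hom_comp, LinearMap.comp_apply, ModuleCat.hom_zero, LinearMap.zero_apply] at h
  exact h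

/-! ### The `r`-path of a multicomplex -/

lemma conn_eq_zero {r : ℕ} {m : ℤ} (X : ℤ × ℤ → ModuleCat.{v} R) {a b : ℤ × ℤ}
    (h : a + (-m, 1 - m) ≠ b) : conn r m X a b = 0 := by
  unfold conn
  rw [dif_neg]
  rintro ⟨rfl, rfl⟩
  apply h
  rw [add_assoc]
  convert add_zero b
  simp [pathShift]

/-- `conn` commutes with `d_i`. -/
lemma conn_comp_d (r i j : ℕ) (a b b' c : ℤ × ℤ) (hb : b = a + (-(j : ℤ), 1 - (j : ℤ)))
    (hb' : b' = a + (-(i : ℤ), 1 - (i : ℤ))) (hj : (j : ℤ) = r) (x : A.X a) :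
    (A.d i (b + pathShift r) (c + pathShift r)).hom ((conn r j A.X a b).hom x) =
      (conn r j A.X b' c).hom ((A.d i a b').hom x) := by
  have e : ((-(j : ℤ), 1 - (j : ℤ)) : ℤ × ℤ) = - pathShift r := by simp [pathShift, hj]
  rw [e] at hb
  obtain rfl : a = b + pathShift r := by rw [hb]; abel
  by_cases hc : b' = c + pathShift r
  · subst hc
    simp [conn, hj]
  · have h1 : conn r j A.X b' c = 0 := by
      unfold conn
      rw [dif_neg fun h => hc h.2]
    rw [h1, A.d_shape i _ _ (by rw [← hb']; exact hc)]
    simp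

/-- The `r`-path of a multicomplex:
`P_r(A)^{p,q} = A^{p,q} ⊕ A^{p+r,q+r-1} ⊕ A^{p,q}` with
`D_i (x, y, z) = (d_i x, (-1)^{i+r+1} d_i y, d_i z)` for `i ≠ r` and
`D_r (x, y, z) = (d_r x, - x - d_r y + z, d_r z)`. -/
noncomputable def path (r : ℕ) : Multicomplex.{u, v} R where
  X a := ModuleCat.of R (A.X a × A.X (a + pathShift r) × A.X a)
  d i a b := ModuleCat.ofHom <|
    pathMap (A.d i a b).hom (A.d i (a + pathShift r) (b + pathShift r)).hom (pathSign r i)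
      (conn r i A.X a b).hom
  d_shape i a b h := by
    have h1 : a + pathShift r + (-(i : ℤ), 1 - (i : ℤ)) ≠ b + pathShift r := by
      rw [add_right_comm]
      exact fun h' => h (add_right_cancel h')
    rw [A.d_shape i a b h, A.d_shape i _ _ h1, conn_eq_zero A.X h]
    refine ModuleCat.hom_ext (LinearMap.ext fun w => ?_)
    refine Prod.ext rfl (Prod.ext ?_ rfl)
    change pathSign r i • (0 : A.X (b + pathShift r)) + 0 = 0
    rw [smul_zero, add_zero]
  rel l a c := by
    refine ModuleCat.hom_ext (LinearMap.ext fun w => ?_)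
    obtain ⟨x, y, z⟩ := w
    rw [ModuleCat.hom_sum, LinearMap.sum_apply]
    have key : ∀ ij ∈ Finset.HasAntidiagonal.antidiagonal l, ∀ b, b = a + (-(ij.2 : ℤ), 1 - (ij.2 : ℤ)) →
        pathSign r ij.1 * pathSign r ij.2 = (-1) ^ l := by
      intro ij hij b _
      unfold pathSign
      rw [← Units.val_mul, ← Int.negOnePow_add, ← Finset.HasAntidiagonal.mem_antidiagonal.1 hij,
        show ((ij.1 : ℤ) + r + 1 + (ij.2 + r + 1)) = ((ij.1 + ij.2 : ℕ) : ℤ) + 2 * (r + 1) by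
          push_cast; ring, Int.negOnePow_add, Int.negOnePow_even (2 * _) (even_two_mul _), mul_one,
        Int.negOnePow_def, zpow_natCast]
      simp
    have hx := A.rel_apply l a c (fun j => a + (-(j : ℤ), 1 - (j : ℤ))) (fun _ => rfl)
    refine Prod.ext ?_ (Prod.ext ?_ ?_)
    · rw [Prod.fst_sum]
      exact hx x
    · rw [Prod.snd_sum, Prod.fst_sum]
      have hy := A.rel_apply l (a + pathShift r) (c + pathShift r)
        (fun j => a + (-(j : ℤ), 1 - (j : ℤ)) + pathShift r) (fun _ => add_right_comm _ _ _) y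
      set b : ℕ → ℤ × ℤ := fun j => a + (-(j : ℤ), 1 - (j : ℤ)) with hbdef
      have e1 : ∀ ij ∈ Finset.HasAntidiagonal.antidiagonal l,
          (-1 : ℤ) ^ ij.1 • (pathSign r ij.1 • (A.d ij.1 (b ij.2 + pathShift r) (c + pathShift r)).hom
            (pathSign r ij.2 • (A.d ij.2 (a + pathShift r) (b ij.2 + pathShift r)).hom y +
              (conn r ij.2 A.X a (b ij.2)).hom (z - x)) +
            (conn r ij.1 A.X (b ij.2) c).hom ((A.d ij.2 a (b ij.2)).hom z -
              (A.d ij.2 a (b ij.2)).hom x)) =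
          (-1 : ℤ) ^ l • ((-1 : ℤ) ^ ij.1 • (A.d ij.1 (b ij.2 + pathShift r)
            (c + pathShift r)).hom ((A.d ij.2 (a + pathShift r) (b ij.2 + pathShift r)).hom y)) +
          (((-1 : ℤ) ^ ij.1 * pathSign r ij.1) • (A.d ij.1 (b ij.2 + pathShift r)
            (c + pathShift r)).hom ((conn r ij.2 A.X a (b ij.2)).hom (z - x)) +
          (-1 : ℤ) ^ ij.1 • (conn r ij.1 A.X (b ij.2) c).hom ((A.d ij.2 a (b ij.2)).hom
            (z - x))) := by
        intro ij hij
        rw [← key ij hij _ rfl, map_add, map_zsmul, ← map_sub (A.d ij.2 a (b ij.2)).hom]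
        module
      refine (Finset.sum_congr rfl e1).trans ?_
      rw [Finset.sum_add_distrib, ← Finset.smul_sum, hy, smul_zero, zero_add,
        Finset.sum_add_distrib]
      rw [← Finset.Nat.sum_antidiagonal_swap (f := fun ij : ℕ × ℕ =>
        (-1 : ℤ) ^ ij.1 • (conn r ij.1 A.X (b ij.2) c).hom ((A.d ij.2 a (b ij.2)).hom (z - x))),
        ← Finset.sum_add_distrib]
      refine Finset.sum_eq_zero fun ij _ => ?_
      dsimp only [Prod.fst_swap, Prod.snd_swap]
      by_cases hj : (ij.2 : ℤ) = r
      · rw [A.conn_comp_d r ij.1 ij.2 a (b ij.2) (b ij.1) c rfl rfl hj, ← add_smul]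
        have hj' : ij.2 = r := by exact_mod_cast hj
        have hs : (-1 : ℤ) ^ ij.1 * pathSign r ij.1 + (-1) ^ ij.2 = 0 := by
          unfold pathSign
          rw [hj', Int.negOnePow_add, Int.negOnePow_add, Int.negOnePow_one]
          have h1 : ∀ k : ℕ, (((k : ℤ).negOnePow : ℤˣ) : ℤ) = (-1) ^ k := by
            intro k; rw [Int.negOnePow_def]; simp
          push_cast
          rw [h1, h1]
          have h2 : ((-1 : ℤ) ^ ij.1) * (-1) ^ ij.1 = 1 := by
            rw [← mul_pow]; simp
          linear_combination (-(-1 : ℤ) ^ r) * h2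
        rw [hs, zero_smul]
      · rw [conn_of_ne hj, conn_of_ne hj]
        simp
    · rw [Prod.snd_sum, Prod.snd_sum]
      exact hx z

/-- The `r`-path functor `P_r` on multicomplexes; a morphism `f` induces `(f, f, f)`. -/
noncomputable def pathFunctor (r : ℕ) : Multicomplex.{u, v} R ⥤ Multicomplex.{u, v} R where
  obj A := A.path r
  map {A B} f :=
    { f := fun a => ModuleCat.ofHom (tripleMap (f.f a).hom (f.f (a + pathShift r)).hom)
      comm := fun i a b => by
        refine ModuleCat.hom_ext (LinearMap.ext fun w => ?_)
        have hc : ∀ x : A.X a, (conn r i B.X a b).hom ((f.f a).hom x) =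
            (f.f (b + pathShift r)).hom ((conn r i A.X a b).hom x) := by
          intro x
          rw [← ModuleCat.comp_apply, ← ModuleCat.comp_apply, conn_comp]
        refine Prod.ext (d_hom_comm f i a b w.1) (Prod.ext ?_ (d_hom_comm f i a b w.2.2))
        change pathSign r i • (B.d i _ _).hom ((f.f _).hom w.2.1) + (conn r i B.X a b).hom
          ((f.f a).hom w.2.2 - (f.f a).hom w.1) = (f.f _).hom (pathSign r i •
            (A.d i _ _).hom w.2.1 + (conn r i A.X a b).hom (w.2.2 - w.1))
        rw [map_add, map_zsmul, d_hom_comm f, ← map_sub, hc] }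
  map_id A := rfl
  map_comp f g := rfl

/-- The natural map `ι_A : A ⟶ P_r(A)`, `x ↦ (x, 0, x)`. -/
noncomputable def ι (r : ℕ) : 𝟭 (Multicomplex.{u, v} R) ⟶ pathFunctor r where
  app A :=
    { f := fun a => ModuleCat.ofHom (LinearMap.prod LinearMap.id (LinearMap.prod 0 LinearMap.id))
      comm := fun i a b => by
        refine ModuleCat.hom_ext (LinearMap.ext fun x => ?_)
        refine Prod.ext rfl (Prod.ext ?_ rfl)
        change pathSign r i • (A.d i _ _).hom 0 + (conn r i A.X a b).hom (x - x) = 0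
        rw [map_zero, smul_zero, sub_self, map_zero, add_zero] }
  naturality A B f := by
    refine Hom.ext (funext fun a => ModuleCat.hom_ext (LinearMap.ext fun x => ?_))
    exact Prod.ext rfl (Prod.ext (map_zero (f.f (a + pathShift r)).hom).symm rfl)

/-- The natural map `∂⁻_A : P_r(A) ⟶ A`, `(x, y, z) ↦ x`. -/
noncomputable def minus (r : ℕ) : pathFunctor r ⟶ 𝟭 (Multicomplex.{u, v} R) where
  app A :=
    { f := fun a => ModuleCat.ofHom (LinearMap.fst R (A.X a) (A.X (a + pathShift r) × A.X a))
      comm := fun _ _ _ => rfl }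
  naturality _ _ _ := rfl

/-- The natural map `∂⁺_A : P_r(A) ⟶ A`, `(x, y, z) ↦ z`. -/
noncomputable def plus (r : ℕ) : pathFunctor r ⟶ 𝟭 (Multicomplex.{u, v} R) where
  app A :=
    { f := fun a => ModuleCat.ofHom (LinearMap.snd R (A.X (a + pathShift r)) (A.X a) ∘ₗ
        LinearMap.snd R (A.X a) (A.X (a + pathShift r) × A.X a))
      comm := fun _ _ _ => rfl }
  naturality _ _ _ := rfl

/-! ### The total filtered complex -/

/-- `F_p Tot(A)^n = ∏_{i ≤ p} A^{i,n+i}`: the families `(a_i)` with `a_i ∈ A^{i,n+i}` and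
`a_i = 0` for `i > p`. -/
def totF (p n : ℤ) : Submodule R (∀ i : ℤ, A.X (i, n + i)) where
  carrier := { a | ∀ i, p < i → a i = 0 }
  zero_mem' _ _ := rfl
  add_mem' ha hb i hi := by rw [Pi.add_apply, ha i hi, hb i hi, add_zero]
  smul_mem' c a ha i hi := by rw [Pi.smul_apply, ha i hi, smul_zero]

/-- `Tot(A)^n = ∏_{i ≤ 0} A^{i,n+i} ⊕ ⨁_{i > 0} A^{i,n+i}`: the families `(a_i)` with
`a_i ∈ A^{i,n+i}` which vanish for all large `i`. -/
def tot (n : ℤ) : Submodule R (∀ i : ℤ, A.X (i, n + i)) where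
  carrier := { a | ∃ p, a ∈ A.totF p n }
  zero_mem' := ⟨0, zero_mem _⟩
  add_mem' := by
    rintro a b ⟨p, ha⟩ ⟨p', hb⟩
    refine ⟨max p p', fun i hi => ?_⟩
    rw [Pi.add_apply, ha i (by lia), hb i (by lia), add_zero]
  smul_mem' c a := by
    rintro ⟨p, ha⟩
    exact ⟨p, Submodule.smul_mem _ c ha⟩

/-- The summand `(-1)^{m n} d_m (a_{j+m})` of the component in `A^{j,n'+j}`, `n' = n + 1`, of the
total differential of `a`. -/
def totTerm (n n' j : ℤ) (a : ∀ i : ℤ, A.X (i, n + i)) (m : ℕ) : A.X (j, n' + j) :=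
  (((m : ℤ) * n).negOnePow : ℤ) • (A.d m (j + m, n + (j + m)) (j, n' + j)).hom (a (j + m))

lemma totTerm_eq_zero {p n n' j : ℤ} {a : ∀ i : ℤ, A.X (i, n + i)} (ha : a ∈ A.totF p n) {m : ℕ}
    (hm : p < j + m) : A.totTerm n n' j a m = 0 := by
  unfold totTerm
  rw [ha _ hm, map_zero, smul_zero]

lemma totTerm_support {n n' j : ℤ} {a : ∀ i : ℤ, A.X (i, n + i)} (ha : a ∈ A.tot n) :
    (Function.support (A.totTerm n n' j a)).Finite := by
  obtain ⟨p, hp⟩ := ha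
  refine (Set.finite_lt_nat (p - j + 1).toNat).subset fun m hm => ?_
  by_contra h
  exact hm (A.totTerm_eq_zero hp (by simp at h; lia))

/-- The total differential `(d a)_j = ∑_{m ≥ 0} (-1)^{m n} d_m (a_{j+m})` (a finite sum, because
`a` vanishes in large indices). -/
noncomputable def totD (n n' : ℤ) : A.tot n →ₗ[R] A.tot n' where
  toFun a := ⟨fun j => ∑ᶠ m : ℕ, A.totTerm n n' j a.1 m, by
    obtain ⟨p, hp⟩ := a.2
    refine ⟨p, fun j hj => finsum_eq_zero_of_forall_eq_zero fun m => A.totTerm_eq_zero hp ?_⟩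
    lia⟩
  map_add' a b := by
    refine Subtype.ext (funext fun j => ?_)
    refine Eq.trans ?_ (finsum_add_distrib (A.totTerm_support a.2) (A.totTerm_support b.2))
    refine finsum_congr fun m => ?_
    unfold totTerm
    rw [← smul_add, ← map_add]
    rfl
  map_smul' c a := by
    refine Subtype.ext (funext fun j => ?_)
    refine Eq.trans ?_ (smul_finsum' c (A.totTerm_support a.2)).symm
    refine finsum_congr fun m => ?_
    unfold totTerm
    refine Eq.trans ?_ (smul_comm c _ _).symm
    refine congrArg (fun t => (((m : ℤ) * n).negOnePow : ℤ) • t) ?_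
    exact map_smul (A.d m (j + m, n + (j + m)) (j, n' + j)).hom c _

lemma totD_apply (n n' : ℤ) (a : A.tot n) (j : ℤ) {N : ℕ}
    (hN : ∀ m, N ≤ m → A.totTerm n n' j a.1 m = 0) :
    (A.totD n n' a).1 j = ∑ m ∈ Finset.range N, A.totTerm n n' j a.1 m := by
  change ∑ᶠ m : ℕ, A.totTerm n n' j a.1 m = _
  refine finsum_eq_sum_of_support_subset _ fun m hm => ?_
  simp only [Finset.coe_range, Set.mem_Iio]
  by_contra h
  exact hm (hN m (by lia))

lemma totD_mem_totF (p n n' : ℤ) (a : A.tot n) (ha : a.1 ∈ A.totF p n) :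
    (A.totD n n' a).1 ∈ A.totF p n' := fun _ _ =>
  finsum_eq_zero_of_forall_eq_zero fun _ => A.totTerm_eq_zero ha (by lia)

lemma totD_totD (n n' n'' : ℤ) (hn : n + 1 = n') (a : A.tot n) :
    A.totD n' n'' (A.totD n n' a) = 0 := by
  obtain ⟨p, hp⟩ := a.2
  refine Subtype.ext (funext fun j => ?_)
  have hp' := A.totD_mem_totF p n n' a hp
  set N : ℕ := (p - j + 1).toNat with hN
  rw [A.totD_apply n' n'' _ j (N := N) (fun m hm => A.totTerm_eq_zero hp' (by lia))]
  have h1 : ∀ m ∈ Finset.range N, A.totTerm n' n'' j (A.totD n n' a).1 m =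
      ∑ k ∈ Finset.range (N - m), ((m : ℤ) * n').negOnePow.val •
        (A.d m (j + m, n' + (j + m)) (j, n'' + j)).hom (A.totTerm n n' (j + m) a.1 k) := by
    intro m hm
    unfold totTerm
    rw [← Finset.smul_sum, ← map_sum]
    congr 2
    exact A.totD_apply n n' a (j + m) (fun k hk => A.totTerm_eq_zero hp (by lia))
  rw [Finset.sum_congr rfl h1, ← Finset.sum_range_diag_flip]
  refine Finset.sum_eq_zero fun l _ => ?_
  rw [← Finset.Nat.sum_antidiagonal_eq_sum_range_succ (fun m k => ((m : ℤ) * n').negOnePow.val •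
        (A.d m (j + m, n' + (j + m)) (j, n'' + j)).hom (A.totTerm n n' (j + m) a.1 k)) l]
  have h2 := A.rel_apply l (j + l, n + (j + l)) (j, n'' + j)
    (fun k => (j + l, n + (j + l)) + (-(k : ℤ), 1 - (k : ℤ))) (fun _ => rfl) (a.1 (j + l))
  have h3 : ∀ (m k : ℕ) (b : ℤ × ℤ) (i : ℤ), b = (j + m, n' + (j + m)) → i = j + m + k →
      (A.d m b (j, n'' + j)).hom ((A.d k (i, n + i) b).hom (a.1 i)) =
      (A.d m (j + m, n' + (j + m)) (j, n'' + j)).hom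
        ((A.d k (j + m + k, n + (j + m + k)) (j + m, n' + (j + m))).hom (a.1 (j + m + k))) := by
    rintro m k b i rfl rfl; rfl
  have h4 := congrArg (fun t => ((l : ℤ) * n).negOnePow.val • t) h2
  simp only [smul_zero, Finset.smul_sum] at h4
  refine Eq.trans (Finset.sum_congr rfl fun ij hij => ?_) h4
  have hl : ij.1 + ij.2 = l := Finset.HasAntidiagonal.mem_antidiagonal.1 hij
  have hl' : (ij.1 : ℤ) + ij.2 = l := by exact_mod_cast hl
  rw [h3 ij.1 ij.2 _ _ (by
    refine Prod.ext ?_ ?_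
    · change j + (l : ℤ) + -(ij.2 : ℤ) = _
      lia
    · change n + (j + (l : ℤ)) + (1 - (ij.2 : ℤ)) = _
      lia) (by lia)]
  unfold totTerm
  rw [map_zsmul, smul_smul, smul_smul]
  congr 1
  have h5 : ∀ k : ℕ, (-1 : ℤ) ^ k = (((k : ℤ).negOnePow : ℤˣ) : ℤ) := by
    intro k; rw [Int.negOnePow_def, zpow_natCast]; simp
  rw [h5, ← Units.val_mul, ← Units.val_mul, ← Int.negOnePow_add, ← Int.negOnePow_add]
  congr 2
  rw [← hl', ← hn]
  ring

/-- The total filtered complex of a multicomplex. -/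
noncomputable def totObj : FilteredComplex.{u, v} R where
  K :=
    { X := fun n => ModuleCat.of R (A.tot n)
      d := fun n n' => ModuleCat.ofHom (A.totD n n')
      shape := fun n n' h => by
        refine ModuleCat.hom_ext (LinearMap.ext fun a => Subtype.ext (funext fun j => ?_))
        refine finsum_eq_zero_of_forall_eq_zero fun m => ?_
        unfold totTerm
        rw [A.d_shape m _ _ fun h' => h ?_]
        · rw [ModuleCat.hom_zero, LinearMap.zero_apply, smul_zero]
        · have h1 := congrArg Prod.snd h'
          change n + (j + m) + (1 - (m : ℤ)) = n' + j at h1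
          change n + 1 = n'
          lia
      d_comp_d' := fun n n' n'' h _ => by
        refine ModuleCat.hom_ext (LinearMap.ext fun a => ?_)
        exact A.totD_totD n n' n'' h a }
  F p n := (A.totF p n).comap (A.tot n).subtype
  mono p n a ha i hi := ha i (by lia)
  d_mem p n a ha := A.totD_mem_totF p n (n + 1) a ha

/-- The totalization functor from multicomplexes to filtered complexes. -/
noncomputable def Tot : Multicomplex.{u, v} R ⥤ FilteredComplex.{u, v} R where
  obj A := A.totObj
  map {A B} f :=
    { f :=
        { f := fun n => ModuleCat.ofHom <|
            ((LinearMap.pi fun i => (f.f (i, n + i)).hom ∘ₗ LinearMap.proj i).restrict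
              (p := A.tot n) (q := B.tot n) (by
                rintro a ⟨p, hp⟩
                refine ⟨p, fun i hi => ?_⟩
                change (f.f (i, n + i)).hom (a i) = 0
                rw [hp i hi, map_zero]))
          comm' := fun n n' _ => by
            refine ModuleCat.hom_ext (LinearMap.ext fun a => Subtype.ext (funext fun j => ?_))
            have h := A.totTerm_support (n' := n') (j := j) a.2
            refine Eq.trans ?_ (map_finsum (f.f (j, n' + j)).hom h).symm
            refine finsum_congr fun m => ?_
            unfold totTerm
            rw [map_zsmul]
            refine congrArg (fun t => (((m : ℤ) * n).negOnePow : ℤ) • t) ?_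
            exact d_hom_comm f m _ _ _ }
      map_mem := fun p n a ha i hi => by
        exact (congrArg (f.f (i, n + i)).hom (ha i hi)).trans (map_zero _) }
  map_id A := rfl
  map_comp f g := rfl

/-- The spectral sequence functor on multicomplexes. Its pages (as bigraded modules) and
characteristic maps are those of the spectral sequence of the filtered complex `Tot(A)`. The signs
of the differentials are those of the explicit description of the spectral sequence in terms of
the multicomplex, where the differential of the page `m` is `[a] ↦ [d_m a + ⋯]`, with leading term
`+ d_m` in all bidegrees: as `d_m` occurs in the total differential with the sign
`(-1)^{m (q - p)}` on `A^{p,q}`, the differential induced by `Tot(A)` on the page `m` is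
multiplied by `(-1)^{m (q - p)}`. -/
noncomputable def specSeq : Multicomplex.{u, v} R ⥤ SpSe.{u, v} R :=
  Tot ⋙ FilteredComplex.spectralSequence ⋙ signTwist

end Multicomplex
end Multicomplexes

end SpecSeqPath

/-! ### Degrees and signs under the shift by `(r, r - 1)`. -/

namespace SpecSeqPath
variable {R : Type u} [CommRing R]

/-! Totalising the `r`-path gives triples: `F_p Tot(P_r A)^n` is `F_p T^n × F_{p+r} T^{n-1} × F_p
T^n` with `T = Tot(A)`, and the differential is `(x, y, z) ↦ (dx, (-1)^{r+1} dy + (-1)^{rn} (z - x),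
dz)`. This is the only input from multicomplexes (`totPathData`, resting on `totMid_totD`); it is
recorded in `PathData`, and everything else concerns filtered complexes.

The connecting term `z - x` starts in filtration `p`, while the middle component is measured in
filtration `p + r`. For `m ≤ r` this gap hides it from the conditions defining `Z_m` and lets it be
absorbed into `B_m`, so both submodules are products of those of `T` (`PathData.mem_Z`,
`PathData.mem_B`) and the page `m` is a module of triples (`tripleE_bijective`). In the page
differential, `z - x` falls into `B_m` if `m < r` and survives with coefficient `1` if `m = r`, once
the signs are normalised (`midE_twistPage_d`). Hence the pages `m ≤ r` are isomorphic to those of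
the path of the spectral sequence. These isomorphisms respect the characteristic maps because a
cycle on the page `m` has a representative in `Z_{m+1}`, to which the middle projection applies
(`pageLow_comm_low`).

Beyond the page `r` nothing is computed. The characteristic map of the path at the page `r` is the
one induced by `∂⁻`, and also the one induced by `∂⁺`. Since the comparison on the page `r` is an
isomorphism, `∂⁻` and `∂⁺` induce one and the same isomorphism on the page `r + 1`, and by induction
on all later pages (`isIso_and_eq_of_lt`). The comparison there is the map induced by `∂⁻`.
Naturality and the compatibilities with the structure maps are read off from the three components.
-/

lemma shape_pathShift_deg (r : ℕ) (i : ℤ × ℤ) :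
    (i + pathShift r).2 - (i + pathShift r).1 + 1 = i.2 - i.1 := by
  simp only [pathShift, Prod.fst_add, Prod.snd_add]
  lia

/-- With `n` the degree of `i`, the shifted bidegree has degree `n - 1`, and the exponents `mn + (r
+ 1)` and `(m + r + 1) + m(n - 1)` agree. This turns the sign `(-1)^{r+1}` of the filtered path,
which does not depend on the page, into the sign `(-1)^{m+r+1}` of the page `m`. -/
lemma twistSign_mul_negOnePow (r : ℕ) (m : ℤ) (i : ℤ × ℤ) :
    ((twistSign m i : ℤˣ) : ℤ) * (((r : ℤ) + 1).negOnePow : ℤˣ) =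
      pathSign r m * ((twistSign m (i + pathShift r) : ℤˣ) : ℤ) := by
  unfold twistSign pathSign
  rw [← Units.val_mul, ← Units.val_mul, ← Int.negOnePow_add, ← Int.negOnePow_add,
    ← shape_pathShift_deg r i]
  congr 2
  ring

/-- For `m = r` this cancels the sign `(-1)^{rn}` in front of `z - x`. -/
lemma twistSign_mul_twistSign (m : ℤ) (i : ℤ × ℤ) :
    ((twistSign m i : ℤˣ) : ℤ) * ((m * (i.2 - i.1)).negOnePow : ℤˣ) = 1 := by
  unfold twistSign
  rw [← Units.val_mul, Int.units_mul_self, Units.val_one]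

/-! ### Paths of filtered complexes: cycles, boundaries and the pages `m ≤ r`. -/

namespace FilteredComplex

/-- The structure of an `r`-path of the filtered complex `T` on the filtered complex `P`: an
identification of `F_p P^n` with `F_p T^n × F_{p+r} T^{n-1} × F_p T^n` for which the differential is
`(x, y, z) ↦ (d x, (-1)^{r+1} d y + (-1)^{r n} (z - x), d z)`. -/
structure PathData (r : ℕ) (P T : FilteredComplex.{u, v} R) where
  /-- the first component -/
  minus : P ⟶ T
  /-- the third component -/
  plus : P ⟶ T
  /-- the second component -/
  mid (n n' : ℤ) (hn : n' + 1 = n) : P.K.X n →ₗ[R] T.K.X n'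
  mid_d (n n' n'' : ℤ) (hn : n' + 1 = n) (hn' : n + 1 = n'') (w : P.K.X n) :
    mid n'' n hn' ((P.K.d n n'').hom w) =
      ((((r : ℤ) + 1).negOnePow : ℤˣ) : ℤ) • (T.K.d n' n).hom (mid n n' hn w) +
        ((((r : ℤ) * n).negOnePow : ℤˣ) : ℤ) • ((plus.f.f n).hom w - (minus.f.f n).hom w)
  ext (n n' : ℤ) (hn : n' + 1 = n) (w w' : P.K.X n) :
    (minus.f.f n).hom w = (minus.f.f n).hom w' → mid n n' hn w = mid n n' hn w' →
      (plus.f.f n).hom w = (plus.f.f n).hom w' → w = w'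
  exists_eq (n n' : ℤ) (hn : n' + 1 = n) (x z : T.K.X n) (y : T.K.X n') :
    ∃ w, (minus.f.f n).hom w = x ∧ mid n n' hn w = y ∧ (plus.f.f n).hom w = z
  mem_F (p n n' : ℤ) (hn : n' + 1 = n) (w : P.K.X n) :
    w ∈ P.F p n ↔ (minus.f.f n).hom w ∈ T.F p n ∧ mid n n' hn w ∈ T.F (p + r) n' ∧
      (plus.f.f n).hom w ∈ T.F p n

lemma hom_d {A B : FilteredComplex.{u, v} R} (f : A ⟶ B) (n n' : ℤ) (x : A.K.X n) :
    (f.f.f n').hom ((A.K.d n n').hom x) = (B.K.d n n').hom ((f.f.f n).hom x) := by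
  rw [← ModuleCat.comp_apply, ← ModuleCat.comp_apply, f.f.comm]

lemma units_zsmul_mem_iff {M : Type v} [AddCommGroup M] [Module R M] (N : Submodule R M) (s : ℤˣ)
    (x : M) : ((s : ℤˣ) : ℤ) • x ∈ N ↔ x ∈ N := by
  rcases Int.units_eq_one_or s with rfl | rfl <;> simp

lemma Z_to_B {T : FilteredComplex.{u, v} R} {m p n : ℤ} {x : T.K.X n}
    (hx : x ∈ T.Z (m - 1) (p - 1) n) : x ∈ T.B m p n :=
  (mem_B (n' := n - 1) (by lia) rfl rfl rfl).2
    ⟨x, hx, 0, zero_mem _, by rw [map_zero, add_zero]⟩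

namespace PathData
variable {r : ℕ} {P T : FilteredComplex.{u, v} R} (D : PathData r P T)

/-- Only the middle component of the differential mixes the coordinates, through `±(z - x)`. This
lies in `F_p`, hence in `F_{p-m+r}` because `m ≤ r`, so it does not affect whether that component
lies in `F_{p-m+r}`. -/
lemma mem_Z {m p p' n n' : ℤ} (hm : m ≤ r) (hn : n' + 1 = n) (hp : p' = p + r) {w : P.K.X n} :
    w ∈ P.Z m p n ↔ (D.minus.f.f n).hom w ∈ T.Z m p n ∧ D.mid n n' hn w ∈ T.Z m p' n' ∧
      (D.plus.f.f n).hom w ∈ T.Z m p n := by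
  subst hp
  rw [FilteredComplex.mem_Z rfl rfl, FilteredComplex.mem_Z rfl rfl,
    FilteredComplex.mem_Z hn rfl, FilteredComplex.mem_Z rfl rfl,
    D.mem_F p n n' hn, D.mem_F (p - m) (n + 1) n rfl, D.mid_d n n' (n + 1) hn rfl,
    hom_d, hom_d]
  have key : (D.minus.f.f n).hom w ∈ T.F p n → (D.plus.f.f n).hom w ∈ T.F p n →
      ((((((r : ℤ) + 1).negOnePow : ℤˣ) : ℤ) • (T.K.d n' n).hom (D.mid n n' hn w) +
        ((((r : ℤ) * n).negOnePow : ℤˣ) : ℤ) •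
          ((D.plus.f.f n).hom w - (D.minus.f.f n).hom w) ∈ T.F (p - m + r) n) ↔
      (T.K.d n' n).hom (D.mid n n' hn w) ∈ T.F (p + r - m) n) := by
    intro h1 h2
    rw [Submodule.add_mem_iff_left, units_zsmul_mem_iff, show p - m + r = p + r - m by lia]
    rw [units_zsmul_mem_iff]
    exact sub_mem (F_mono (by lia) h2) (F_mono (by lia) h1)
  tauto

lemma exists_mem_Z {m p p' n n' : ℤ} (hm : m ≤ r) (hn : n' + 1 = n) (hp : p' = p + r)
    {x z : T.K.X n} {y : T.K.X n'} (hx : x ∈ T.Z m p n) (hy : y ∈ T.Z m p' n')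
    (hz : z ∈ T.Z m p n) : ∃ w ∈ P.Z m p n,
      (D.minus.f.f n).hom w = x ∧ D.mid n n' hn w = y ∧ (D.plus.f.f n).hom w = z := by
  obtain ⟨w, rfl, rfl, rfl⟩ := D.exists_eq n n' hn x z y
  exact ⟨w, (D.mem_Z hm hn hp).2 ⟨hx, hy, hz⟩, rfl, rfl, rfl⟩

/-- The inclusions used are `F_{p+m-1} ⊆ F_{p+r-1}` for `z - x` and `F_p ⊆ F_{p+r-m}` for its
differential. Thus the connecting term of a boundary lies in the first summand of `B_m^{p+r}`. -/
lemma sub_mem_Z {m p p' n : ℤ} (hm : m ≤ r) (hp : p' = p + r) {w : P.K.X n}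
    (hw : w ∈ P.Z (m - 1) (p + m - 1) n) :
    (D.plus.f.f n).hom w - (D.minus.f.f n).hom w ∈ T.Z (m - 1) (p' - 1) n := by
  have h := sub_mem (map_Z D.plus hw) (map_Z D.minus hw)
  rw [FilteredComplex.mem_Z rfl rfl] at h ⊢
  exact ⟨F_mono (by lia) h.1, F_mono (by lia) h.2⟩

/-- The connecting term created by `d Z_{m-1}^{p+m-1}` belongs to the other summand `Z_{m-1}` of the
middle component, by `sub_mem_Z`, so it can be moved from one summand to the other in either
direction. -/
lemma mem_B {m p p' n n' : ℤ} (hm : m ≤ r) (hn : n' + 1 = n) (hp : p' = p + r) {w : P.K.X n} :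
    w ∈ P.B m p n ↔ (D.minus.f.f n).hom w ∈ T.B m p n ∧ D.mid n n' hn w ∈ T.B m p' n' ∧
      (D.plus.f.f n).hom w ∈ T.B m p n := by
  have hn'' : n' - 1 + 1 = n' := by lia
  constructor
  · intro h
    refine ⟨map_B D.minus h, ?_, map_B D.plus h⟩
    obtain ⟨a, ha, b, hb, rfl⟩ := (FilteredComplex.mem_B hn rfl rfl rfl).1 h
    rw [map_add, D.mid_d n' (n' - 1) n hn'' hn]
    have ha' := (D.mem_Z (p' := p' - 1) (by lia) hn (by lia)).1 ha
    have hb' := (D.mem_Z (p' := p' + m - 1) (by lia) hn'' (by lia)).1 hb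
    refine add_mem (Z_to_B ha'.2.1) (add_mem ?_ (Z_to_B ?_))
    · rw [units_zsmul_mem_iff]
      exact (FilteredComplex.mem_B hn'' rfl rfl rfl).2
        ⟨0, zero_mem _, _, hb'.2.1, zero_add _⟩
    · rw [units_zsmul_mem_iff]
      exact D.sub_mem_Z hm hp hb
  · rintro ⟨hx, hy, hz⟩
    obtain ⟨x, hx, x', hx', hxx⟩ := (FilteredComplex.mem_B hn rfl rfl rfl).1 hx
    obtain ⟨y, hy, y', hy', hyy⟩ := (FilteredComplex.mem_B hn'' rfl rfl rfl).1 hy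
    obtain ⟨z, hz, z', hz', hzz⟩ := (FilteredComplex.mem_B hn rfl rfl rfl).1 hz
    -- The middle component of `b` is `(-1)^{r+1} y'`: the sign squares to one, so the middle
    -- component of `d b` contains exactly `d y'`.
    obtain ⟨b, hb, rfl, hb2, rfl⟩ := D.exists_mem_Z (p := p + m - 1) (p' := p' + m - 1) (by lia) hn''
      (by lia) hx' (((T.Z (m - 1) (p' + m - 1) (n' - 1)).smul_of_tower_mem
        (((((r : ℤ) + 1).negOnePow : ℤˣ) : ℤ)) hy')) hz'
    have hs := D.sub_mem_Z hm hp hb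
    -- The remaining part `(-1)^{r n'} (z' - x')` of `d b` is compensated by subtracting it from `y`
    -- in the middle component of `a`.
    obtain ⟨a, ha, ha1, ha2, ha3⟩ := D.exists_mem_Z (p := p - 1) (p' := p' - 1) (by lia) hn
      (by lia) hx (sub_mem hy ((T.Z (m - 1) (p' - 1) n').smul_of_tower_mem
        (((((r : ℤ) * n').negOnePow : ℤˣ) : ℤ)) hs)) hz
    refine (FilteredComplex.mem_B hn rfl rfl rfl).2 ⟨a, ha, b, hb, D.ext n n' hn _ _ ?_ ?_ ?_⟩
    · rw [map_add, ha1, hom_d, hxx]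
    · rw [map_add, ha2, D.mid_d n' (n' - 1) n hn'' hn, hb2, map_zsmul, units_zsmul_zsmul, ← hyy]
      abel
    · rw [map_add, ha3, hom_d, hzz]

/-- The second component, on the pages `m ≤ r`. -/
noncomputable def midE (m : ℤ) (hm : m ≤ r) (i : ℤ × ℤ) : P.E m i →ₗ[R] T.E m (i + pathShift r) :=
  Submodule.mapQ _ _
    ((D.mid (i.2 - i.1) _ (shape_pathShift_deg r i)).restrict
      (fun _ hx => ((D.mem_Z hm (shape_pathShift_deg r i) rfl).1 hx).2.1))
    (fun _ hx => ((D.mem_B hm (shape_pathShift_deg r i) rfl).1 hx).2.1)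

/-- The identification of the pages `m ≤ r` with triples. -/
noncomputable def tripleE (m : ℤ) (hm : m ≤ r) (i : ℤ × ℤ) :
    P.E m i →ₗ[R] T.E m i × T.E m (i + pathShift r) × T.E m i :=
  (mapE D.minus m i).prod ((D.midE m hm i).prod (mapE D.plus m i))

/-- Injectivity is the product description of `B_m`, and surjectivity comes from lifting triples of
representatives to `Z_m`. -/
lemma tripleE_bijective (m : ℤ) (hm : m ≤ r) (i : ℤ × ℤ) :
    Function.Bijective (D.tripleE m hm i) := by
  constructor
  · rw [injective_iff_map_eq_zero]
    intro w hw
    obtain ⟨w, rfl⟩ := Submodule.mkQ_surjective _ w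
    refine cls_eq_zero.2 ((D.mem_B hm (shape_pathShift_deg r i) rfl).2 ⟨?_, ?_, ?_⟩)
    · exact cls_eq_zero.1 (congrArg (fun t => t.1) hw)
    · exact cls_eq_zero.1 (congrArg (fun t => t.2.1) hw)
    · exact cls_eq_zero.1 (congrArg (fun t => t.2.2) hw)
  · rintro ⟨x, y, z⟩
    obtain ⟨⟨x, hx⟩, rfl⟩ := Submodule.mkQ_surjective _ x
    obtain ⟨⟨y, hy⟩, rfl⟩ := Submodule.mkQ_surjective _ y
    obtain ⟨⟨z, hz⟩, rfl⟩ := Submodule.mkQ_surjective _ z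
    obtain ⟨w, hw, rfl, rfl, rfl⟩ := D.exists_mem_Z hm (shape_pathShift_deg r i) rfl hx hy hz
    exact ⟨P.cls m i ⟨w, hw⟩, rfl⟩

lemma twistPage_page_d_cls (m : ℤ) {i j : ℤ × ℤ} (h : (shape m).Rel i j)
    (x : T.Z m i.1 (i.2 - i.1)) :
    ((twistPage (T.page m)).d i j).hom (T.cls m i x) =
      T.cls m j (((twistSign m i : ℤˣ) : ℤ) •
        ⟨(T.K.d _ _).hom x.1, d_Z (rel_deg h).1 (rel_deg h).2 x.2⟩) := by
  refine (congrArg (fun g => ((twistSign m i : ℤˣ) : ℤ) • g (T.cls m i x)) (page_d T m h)).trans ?_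
  exact (congrArg (((twistSign m i : ℤˣ) : ℤ) • ·) (δ_cls T m h x)).trans
    (map_zsmul (T.cls m j) _ _).symm

/-- Here `s` stands for the normalising sign at the source, `t` for the sign of the middle
differential of the path, and `t'` for the normalising sign at the shifted source; `hs` is then
`twistSign_mul_negOnePow`. -/
lemma mid_zsmul_d (n n' n'' s t t' : ℤ) (hn : n' + 1 = n) (hn' : n + 1 = n'')
    (hs : s * ((((r : ℤ) + 1).negOnePow : ℤˣ) : ℤ) = t * t') (w : P.K.X n) :
    D.mid n'' n hn' (s • (P.K.d n n'').hom w) =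
      t • t' • (T.K.d n' n).hom (D.mid n n' hn w) +
        (s * ((((r : ℤ) * n).negOnePow : ℤˣ) : ℤ)) •
          ((D.plus.f.f n).hom w - (D.minus.f.f n).hom w) := by
  rw [map_zsmul, D.mid_d n n' n'' hn hn', smul_add, smul_smul, smul_smul, smul_smul, hs]

/-- The discrepancy is a multiple of `z - x`. As `m < r`, its filtration satisfies `p ≤ p - m + r -
1`, and its differential is in `F_{p-m}`, so it lies in `Z_{m-1}^{p'-1}`, the first summand of
`B_m^{p'}`. The equal degrees `n` and `k` have separate names because they arise from different
bidegrees. -/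
lemma mid_zsmul_d_sub_mem_B {m p p' n n' n'' k : ℤ} (hm : m < r) (s t t' : ℤ) (hn : n' + 1 = n)
    (hn' : n + 1 = n'') (hk : k + 1 = n'') (hp : p' = p - m + r)
    (hs : s * ((((r : ℤ) + 1).negOnePow : ℤˣ) : ℤ) = t * t') {w : P.K.X n} (hw : w ∈ P.Z m p n) :
    D.mid n'' k hk (s • (P.K.d n n'').hom w) -
      t • t' • (T.K.d n' k).hom (D.mid n n' hn w) ∈ T.B m p' k := by
  obtain rfl : k = n := by lia
  rw [D.mid_zsmul_d k n' n'' s t t' hn hn' hs, add_sub_cancel_left]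
  refine Z_to_B (Submodule.smul_of_tower_mem _ _ ?_)
  have h := sub_mem (map_Z D.plus hw) (map_Z D.minus hw)
  rw [FilteredComplex.mem_Z rfl rfl] at h ⊢
  exact ⟨F_mono (by lia) h.1, F_mono (by lia) h.2⟩

/-- The connecting term is an honest summand for `m = r` and is a boundary for `m < r`. This is the
only component where commutation with the differential is not functoriality. -/
lemma midE_twistPage_d (m : ℤ) (hm : m ≤ r) {i j : ℤ × ℤ} (h : (shape m).Rel i j)
    (w : P.E m i) :
    D.midE m hm j (((twistPage (P.page m)).d i j).hom w) =
      pathSign r m • ((twistPage (T.page m)).d (i + pathShift r) (j + pathShift r)).hom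
        (D.midE m hm i w) +
      (conn r m (twistPage (T.page m)).X i j).hom (mapE D.plus m i w - mapE D.minus m i w) := by
  obtain ⟨w, rfl⟩ := Submodule.mkQ_surjective _ w
  have hr := rel_deg h
  have hw : D.mid (i.2 - i.1) _ (shape_pathShift_deg r i) w.1 ∈ T.Z m (i + pathShift r).1 _ :=
    ((D.mem_Z hm (shape_pathShift_deg r i) rfl).1 w.2).2.1
  refine (congrArg (D.midE m hm j) (twistPage_page_d_cls m h w)).trans ?_
  refine Eq.trans ?_ (congrArg (fun t => pathSign r m • t + (conn r m (twistPage (T.page m)).X i j).hom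
    (mapE D.plus m i (P.cls m i w) - mapE D.minus m i (P.cls m i w)))
    (twistPage_page_d_cls m (shape_shift r h) ⟨_, hw⟩)).symm
  by_cases hmr : m = r
  · subst hmr
    -- On the page `r` the source `i` is the shifted target `j + (r, r - 1)`, so that `conn` becomes
    -- the identity.
    obtain rfl := eq_add_pathShift rfl h
    have e : conn r r (twistPage (T.page r)).X (j + pathShift r) j = 𝟙 _ := by
      unfold conn
      rw [dif_pos ⟨rfl, rfl⟩]
      rfl
    rw [e]
    have h1 := D.mid_zsmul_d _ _ _ _ _ _ (shape_pathShift_deg r (j + pathShift r)) hr.1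
      (twistSign_mul_negOnePow r r (j + pathShift r)) w.1
    rw [twistSign_mul_twistSign, one_smul] at h1
    exact congrArg (T.cls _ (j + pathShift r)) (Subtype.ext h1)
  · rw [conn_of_ne hmr]
    refine Eq.trans ?_ (add_zero _).symm
    refine sub_eq_zero.1 (cls_eq_zero.2 ?_)
    exact D.mid_zsmul_d_sub_mem_B (p := i.1) (by lia) _ _ _ _ hr.1 _
      (by rw [← hr.2]; rfl) (twistSign_mul_negOnePow r m i) w.2

/-- The pages `m ≤ r` of the comparison morphism. -/
noncomputable def pageLow (m : ℤ) (hm : m ≤ r) :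
    twistPage (P.page m) ⟶ lowPath r (twistPage (T.page m)) where
  f i := ModuleCat.ofHom (D.tripleE m hm i)
  comm' i j h := by
    refine ModuleCat.hom_ext (LinearMap.ext fun w => ?_)
    refine Prod.ext ?_ (Prod.ext (D.midE_twistPage_d m hm h w).symm ?_)
    · exact congrArg (fun g => g.hom w) (((twistPageFunctor m).map (mapPage D.minus m)).comm i j)
    · exact congrArg (fun g => g.hom w) (((twistPageFunctor m).map (mapPage D.plus m)).comm i j)

lemma isIso_pageLow (m : ℤ) (hm : m ≤ r) : IsIso (D.pageLow m hm) := by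
  have : ∀ i, IsIso ((D.pageLow m hm).f i) := fun i =>
    (ConcreteCategory.isIso_iff_bijective _).2 (D.tripleE_bijective m hm i)
  exact HomologicalComplex.Hom.isIso_of_components _

end PathData
end FilteredComplex

/-! ### Morphisms into the path of a spectral sequence, determined by the pages `m ≤ r`. -/

/-- A morphism of spectral sequences which is an isomorphism on all pages is an isomorphism. -/
lemma isIso_of_isIso_hom {A B : SpSe.{u, v} R} (f : A ⟶ B)
    (h : ∀ (m : ℤ) (h0 : 0 ≤ m), IsIso (f.hom m h0)) : IsIso f := by
  refine ⟨⟨{ hom := fun m h0 => @inv _ _ _ _ (f.hom m h0) (h m h0), comm := ?_ }, ?_, ?_⟩⟩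
  · intro m m' pq hm h0
    have := h m h0
    have := h m' (by lia)
    -- Compatibility of the inverses may be tested after precomposition with the isomorphism induced
    -- by `f` on homology, where it reduces to the compatibility of `f`.
    rw [← cancel_epi (HomologicalComplex.homologyMap (f.hom m) pq), ← Category.assoc,
      ← HomologicalComplex.homologyMap_comp, IsIso.hom_inv_id, HomologicalComplex.homologyMap_id,
      Category.id_comp, ← Category.assoc, f.comm m m' pq, Category.assoc,
      ← HomologicalComplex.comp_f, IsIso.hom_inv_id]
    exact (Category.comp_id _).symm
  · ext1 m h0
    exact @IsIso.hom_inv_id _ _ _ _ (f.hom m h0) (h m h0)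
  · ext1 m h0
    exact @IsIso.inv_hom_id _ _ _ _ (f.hom m h0) (h m h0)

/-- Families of maps `A_m → P_m(r; B)` for `m ≤ r` which are part of a morphism `A ⟶ P(r; B)` of
spectral sequences with given components `minus` and `plus`. -/
structure PathComparison (r : ℕ) (A B : SpSe.{u, v} R) where
  /-- the first component -/
  minus : A ⟶ B
  /-- the third component -/
  plus : A ⟶ B
  /-- the maps on the pages `m ≤ r` -/
  low (m : ℤ) (h0 : 0 ≤ m) (h : m ≤ r) : A.page m h0 ⟶ (lowPathFunctor r m).obj (B.page m h0)
  low_minus (m : ℤ) (h0 : 0 ≤ m) (h : m ≤ r) :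
    low m h0 h ≫ (lowMinus r m).app (B.page m h0) = minus.hom m h0
  low_plus (m : ℤ) (h0 : 0 ≤ m) (h : m ≤ r) :
    low m h0 h ≫ (lowPlus r m).app (B.page m h0) = plus.hom m h0
  low_comm (m m' : ℤ) (pq : ℤ × ℤ) (hm : m + 1 = m') (h0 : 0 ≤ m) (h0' : 0 ≤ m') (h : m' ≤ r)
      (h1 : m ≤ r) (h2 : m ≠ r) :
    HomologicalComplex.homologyMap (low m h0 h1) pq ≫ (lowIso r B m m' pq hm h0 h2).hom =
      (A.iso m m' pq hm h0).hom ≫ (low m' h0' h).f pq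
  isIso_low (m : ℤ) (h0 : 0 ≤ m) (h : m ≤ r) : IsIso (low m h0 h)

namespace PathComparison
variable {r : ℕ} {A B : SpSe.{u, v} R} (L : PathComparison r A B)

/-- By `topIso_minus`, the characteristic map of the path at the page `r` is `∂⁻` on homology
followed by that of `B`. The square is therefore the compatibility of `L.minus` itself. -/
lemma low_comm_top (m m' : ℤ) (pq : ℤ × ℤ) (hm : m + 1 = m') (h0 : 0 ≤ m) (h0' : 0 ≤ m')
    (h1 : m ≤ r) (h2 : m = r) :
    HomologicalComplex.homologyMap (L.low m h0 h1) pq ≫ (topIso r B m m' pq hm h0 h2).hom =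
      (A.iso m m' pq hm h0).hom ≫ (L.minus.hom m' h0').f pq := by
  refine (congrArg (HomologicalComplex.homologyMap (L.low m h0 h1) pq ≫ ·)
    (topIso_minus r B m m' pq hm h0 h2)).symm.trans ?_
  refine (Category.assoc _ _ _).symm.trans ?_
  rw [← HomologicalComplex.homologyMap_comp, L.low_minus]
  exact L.minus.comm m m' pq hm h0

/-- The second factorisation of the same map, now through `∂⁺`; comparing it with `low_comm_top`
forces `L.minus` and `L.plus` to agree on the page `r + 1`. -/
lemma low_comm_top' (m m' : ℤ) (pq : ℤ × ℤ) (hm : m + 1 = m') (h0 : 0 ≤ m) (h0' : 0 ≤ m')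
    (h1 : m ≤ r) (h2 : m = r) :
    HomologicalComplex.homologyMap (L.low m h0 h1) pq ≫ (topIso r B m m' pq hm h0 h2).hom =
      (A.iso m m' pq hm h0).hom ≫ (L.plus.hom m' h0').f pq := by
  refine (congrArg (HomologicalComplex.homologyMap (L.low m h0 h1) pq ≫ ·)
    (topIso_plus r B m m' pq hm h0 h2)).symm.trans ?_
  refine (Category.assoc _ _ _).symm.trans ?_
  rw [← HomologicalComplex.homologyMap_comp, L.low_plus]
  exact L.plus.comm m m' pq hm h0

/-- The comparison morphism on the page `m`. -/
noncomputable def pageHom (m : ℤ) (h0 : 0 ≤ m) :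
    A.page m h0 ⟶ (pathPage r m).obj (B.page m h0) :=
  if h : m ≤ r then L.low m h0 h ≫ (pathPageLow r m h).inv.app _
  else L.minus.hom m h0 ≫ (pathPageHigh r m h).inv.app _

lemma pageHom_low (m : ℤ) (h0 : 0 ≤ m) (h : m ≤ r) :
    L.pageHom m h0 ≫ ((pathPageLow r m h).app _).hom = L.low m h0 h := by
  rw [pageHom, dif_pos h, Category.assoc, Iso.app_hom, Iso.inv_hom_id_app, Category.comp_id]

lemma pageHom_high (m : ℤ) (h0 : 0 ≤ m) (h : ¬ m ≤ r) :
    L.pageHom m h0 ≫ ((pathPageHigh r m h).app _).hom = L.minus.hom m h0 := by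
  rw [pageHom, dif_neg h, Category.assoc, Iso.app_hom, Iso.inv_hom_id_app]
  exact Category.comp_id _

/-- In each of the regimes `m < r`, `m = r` and `m > r`, `conjIso_comm` removes the identifications
of the pages of the path, leaving the given compatibility, `low_comm_top` and the compatibility of
`L.minus` respectively. -/
lemma pageHom_comm (m m' : ℤ) (pq : ℤ × ℤ) (hm : m + 1 = m') (h0 : 0 ≤ m) (h0' : 0 ≤ m') :
    HomologicalComplex.homologyMap (L.pageHom m h0) pq ≫ (pathIso r B m m' pq hm h0).hom =
      (A.iso m m' pq hm h0).hom ≫ (L.pageHom m' h0').f pq := by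
  rw [iso_eq_conjIso A m m' pq hm h0]
  by_cases h : m' ≤ r
  · have h1 : m ≤ r := by lia
    have h2 : m ≠ r := by lia
    rw [pathIso_low r B m m' pq hm h0 h h1 h2]
    exact conjIso_comm _ _ _ _ _ _ _ _ (L.low m h0 h1) _ (L.low m' h0' h)
      ((L.pageHom_low m h0 h1).trans (Category.id_comp _).symm)
      ((L.pageHom_low m' h0' h).trans (Category.id_comp _).symm)
      (L.low_comm m m' pq hm h0 h0' h h1 h2)
  by_cases h2 : m = r
  · have h1 : m ≤ r := by lia
    rw [pathIso_top r B m m' pq hm h0 h h1 h2]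
    exact conjIso_comm _ _ _ _ _ _ _ _ (L.low m h0 h1) _ (L.minus.hom m' h0')
      ((L.pageHom_low m h0 h1).trans (Category.id_comp _).symm)
      ((L.pageHom_high m' h0' h).trans (Category.id_comp _).symm)
      (L.low_comm_top m m' pq hm h0 h0' h1 h2)
  · have h1 : ¬ m ≤ r := by lia
    rw [pathIso_high r B m m' pq hm h0 h h1 h2]
    exact conjIso_comm _ _ _ _ _ _ _ _ (L.minus.hom m h0) _ (L.minus.hom m' h0')
      ((L.pageHom_high m h0 h1).trans (Category.id_comp _).symm)
      ((L.pageHom_high m' h0' h).trans (Category.id_comp _).symm)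
      (L.minus.comm m m' pq hm h0)

/-- The morphism `A ⟶ P(r; B)`. -/
noncomputable def toPath : A ⟶ (pathSpSe r).obj B where
  hom m h0 := L.pageHom m h0
  comm m m' pq hm h0 := L.pageHom_comm m m' pq hm h0 _

/-- On the pages `m > r` both projections induce the same isomorphism. -/
lemma isIso_and_eq_of_lt (k : ℕ) : ∀ (m : ℤ) (h0 : 0 ≤ m), m = r + 1 + k →
    IsIso (L.minus.hom m h0) ∧ L.minus.hom m h0 = L.plus.hom m h0 := by
  -- If one isomorphism `g` equals the characteristic isomorphism of `A` followed by either
  -- projection, cancelling the latter isomorphism gives both claims on the page `m'`.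
  have key : ∀ (m m' : ℤ) (hm : m + 1 = m') (h0 : 0 ≤ m) (h0' : 0 ≤ m')
      (g : ∀ pq, (A.page m h0).homology pq ⟶ (B.page m' h0').X pq),
      (∀ pq, IsIso (g pq)) →
      (∀ pq, g pq = (A.iso m m' pq hm h0).hom ≫ (L.minus.hom m' h0').f pq) →
      (∀ pq, g pq = (A.iso m m' pq hm h0).hom ≫ (L.plus.hom m' h0').f pq) →
      IsIso (L.minus.hom m' h0') ∧ L.minus.hom m' h0' = L.plus.hom m' h0' := by
    intro m m' hm h0 h0' g hg h1 h2
    constructor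
    · have : ∀ pq, IsIso ((L.minus.hom m' h0').f pq) := fun pq => by
        have h4 := hg pq
        rw [h1 pq] at h4
        exact IsIso.of_isIso_comp_left (A.iso m m' pq hm h0).hom _
      exact HomologicalComplex.Hom.isIso_of_components _
    · refine HomologicalComplex.Hom.ext (funext fun pq => ?_)
      rw [← cancel_epi (A.iso m m' pq hm h0).hom, ← h1, h2]
  induction k with
  | zero =>
    intro m' h0' hm'
    have hm : (r : ℤ) + 1 = m' := by lia
    have h0 : (0 : ℤ) ≤ r := by lia
    refine key r m' hm h0 h0' _ (fun pq => ?_)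
      (fun pq => L.low_comm_top r m' pq hm h0 h0' le_rfl rfl)
      (fun pq => L.low_comm_top' r m' pq hm h0 h0' le_rfl rfl)
    -- On the page `r + 1`, `g` is the homology of the page-`r` comparison followed by `topIso`,
    -- both isomorphisms.
    have := L.isIso_low r h0 le_rfl
    have h1 : IsIso (HomologicalComplex.homologyMap (L.low r h0 le_rfl) pq) := inferInstance
    exact IsIso.comp_isIso' h1 (Iso.isIso_hom (topIso r B r m' pq hm h0 rfl))
  | succ k ih =>
    intro m' h0' hm'
    obtain ⟨m, hm⟩ : ∃ m : ℤ, m + 1 = m' := ⟨m' - 1, by lia⟩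
    have h0 : 0 ≤ m := by lia
    obtain ⟨h1, h2⟩ := ih m h0 (by push_cast at hm'; lia)
    refine key m m' hm h0 h0' _ (fun pq => ?_) (fun pq => L.minus.comm m m' pq hm h0)
      (fun pq => ?_)
    · infer_instance
    -- The homology maps of the two projections coincide, since the projections already agree on the
    -- page `m`.
    · rw [h2]
      exact L.plus.comm m m' pq hm h0

lemma isIso_pageHom (m : ℤ) (h0 : 0 ≤ m) : IsIso (L.pageHom m h0) := by
  unfold pageHom
  split_ifs with h
  · have := L.isIso_low m h0 h
    infer_instance
  · have := (L.isIso_and_eq_of_lt (m - r - 1).toNat m h0 (by lia)).1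
    exact IsIso.comp_isIso' this inferInstance

lemma isIso_toPath : IsIso L.toPath := isIso_of_isIso_hom _ fun m h0 => L.isIso_pageHom m h0

lemma toPath_minus : L.toPath ≫ (minusSpSe r).app B = L.minus := by
  ext1 m h0
  change L.pageHom m h0 ≫ (pathPageMinus r m).app _ = _
  by_cases h : m ≤ r
  · rw [pathPageMinus_low r m h, NatTrans.comp_app, ← Category.assoc, ← Iso.app_hom,
      L.pageHom_low m h0 h, L.low_minus]
  · rw [pathPageMinus, dif_neg h]
    exact L.pageHom_high m h0 h

/-- On the pages `m > r` the morphism was defined with `L.minus`, so the equality of the two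
projections there is indispensable. -/
lemma toPath_plus : L.toPath ≫ (plusSpSe r).app B = L.plus := by
  ext1 m h0
  change L.pageHom m h0 ≫ (pathPagePlus r m).app _ = _
  by_cases h : m ≤ r
  · rw [pathPagePlus_low r m h, NatTrans.comp_app, ← Category.assoc, ← Iso.app_hom,
      L.pageHom_low m h0 h, L.low_plus]
  · rw [pathPagePlus, dif_neg h]
    exact (L.pageHom_high m h0 h).trans
      (L.isIso_and_eq_of_lt (m - r - 1).toNat m h0 (by lia)).2

/-- The section property for `L.minus` settles the pages `m > r`; the pages `m ≤ r` need the full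
triple, including the vanishing of its middle entry. -/
lemma comp_toPath_eq_ι (j : B ⟶ A) (hj : j ≫ L.minus = 𝟙 B)
    (h : ∀ (m : ℤ) (h0 : 0 ≤ m) (h : m ≤ r),
      j.hom m h0 ≫ L.low m h0 h = (lowι r m).app (B.page m h0)) :
    j ≫ L.toPath = (ιSpSe r).app B := by
  ext1 m h0
  change j.hom m h0 ≫ L.pageHom m h0 = (pathPageι r m).app _
  by_cases hm : m ≤ r
  · rw [pathPageι_low r m hm, pageHom, dif_pos hm, ← Category.assoc, h m h0 hm]
    rfl
  · have h1 : j.hom m h0 ≫ L.minus.hom m h0 = 𝟙 _ := congrArg (fun t => t.hom m h0) hj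
    rw [pathPageι, dif_neg hm, pageHom, dif_neg hm, ← Category.assoc, h1]
    exact Category.id_comp _

lemma toPath_natural {A' B' : SpSe.{u, v} R} (L' : PathComparison r A' B') (g : A ⟶ A')
    (f : B ⟶ B') (hminus : g ≫ L'.minus = L.minus ≫ f)
    (h : ∀ (m : ℤ) (h0 : 0 ≤ m) (h : m ≤ r), g.hom m h0 ≫ L'.low m h0 h =
      L.low m h0 h ≫ (lowPathFunctor r m).map (f.hom m h0)) :
    g ≫ L'.toPath = L.toPath ≫ (pathSpSe r).map f := by
  ext1 m h0
  change g.hom m h0 ≫ L'.pageHom m h0 = L.pageHom m h0 ≫ (pathPage r m).map (f.hom m h0)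
  unfold pageHom
  split_ifs with hm
  · rw [Category.assoc, ← NatTrans.naturality, ← Category.assoc, ← Category.assoc, h m h0 hm]
  · have h1 : g.hom m h0 ≫ L'.minus.hom m h0 = L.minus.hom m h0 ≫ f.hom m h0 :=
      congrArg (fun t => t.hom m h0) hminus
    rw [Category.assoc, ← NatTrans.naturality, ← Category.assoc, h1]
    exact Category.assoc _ _ _

end PathComparison

/-! ### Characteristic maps on representatives, and the comparison for filtered complexes. -/

namespace FilteredComplex

/-- The spectral sequence of a filtered complex, with signs of the differentials normalised by
`signTwist`. -/
noncomputable abbrev signedSpSe : FilteredComplex.{u, v} R ⥤ SpSe.{u, v} R :=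
  spectralSequence ⋙ signTwist

/-- Changing signs leaves the cycles and the value of the characteristic map unchanged; `x` and `y`
are one element seen in the kernels of two differentials. -/
lemma charMap_signedSpSe (T : FilteredComplex.{u, v} R) (m m' : ℤ) (hm : m + 1 = m') (h0 : 0 ≤ m)
    {i j : ℤ × ℤ} (h : (shape m).Rel i j) (x : LinearMap.ker ((T.page m).d i j).hom)
    (y : LinearMap.ker ((twistPage (T.page m)).d i j).hom) (hy : y.1 = x.1) :
    charMap (signedSpSe.obj T) m m' hm h0 h y = charMap (spectralSequence.obj T) m m' hm h0 h x := by
  obtain rfl : i + (-m, 1 - m) = j := h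
  change (twistIso (spectralSequence.obj T) m m' i hm h0).hom.hom
    (cycleClass (twistPage (T.page m)) (shape_next m i) y) = _
  unfold twistIso
  exact homologyIso_cycleClass _ _ _ _ _ _ _ _ _ _ _ hy

lemma Z_succ_le' {T : FilteredComplex.{u, v} R} {m m' p n : ℤ} (hm : m + 1 = m') :
    T.Z m' p n ≤ T.Z m p n := by
  subst hm
  exact Z_succ_le

lemma charMap_cls (T : FilteredComplex.{u, v} R) (m m' : ℤ) (hm : m + 1 = m') (h0 : 0 ≤ m)
    {i j : ℤ × ℤ} (h : (shape m).Rel i j) (w : T.K.X (i.2 - i.1))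
    (hw : w ∈ T.Z m' i.1 (i.2 - i.1)) (x : LinearMap.ker ((T.page m).d i j).hom)
    (hx : x.1 = T.cls m i ⟨w, Z_succ_le' hm hw⟩) :
    charMap (spectralSequence.obj T) m m' hm h0 h x = T.cls m' i ⟨w, hw⟩ := by
  obtain rfl : i + (-m, 1 - m) = j := h
  change (T.pageIso m m' i hm h0).hom.hom (cycleClass (T.page m) (shape_next m i) x) = _
  unfold pageIso
  exact homologyIso_cycleClass (T.page m) _ _ _ _ _ _ _ _
    (⟨w, hw⟩ : T.Z m' i.1 (i.2 - i.1)) _ hx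

/-- A cycle of the page `m` is represented by an element of `Z_{m+1}`. -/
lemma exists_Z_succ_of_cycle (T : FilteredComplex.{u, v} R) (m m' : ℤ) (hm : m + 1 = m')
    {i j : ℤ × ℤ} (h : (shape m).Rel i j) (x : T.E m i) (hx : ((T.page m).d i j).hom x = 0) :
    ∃ (w : T.K.X (i.2 - i.1)) (hw : w ∈ T.Z m' i.1 (i.2 - i.1)),
      x = T.cls m i ⟨w, Z_succ_le' hm hw⟩ := by
  subst hm
  obtain ⟨x, rfl⟩ := Submodule.mkQ_surjective _ x
  have hr := rel_deg h
  -- Being a cycle means `dx = b + dc` with `b ∈ Z_{m-1}^{p-m-1}` and `c ∈ Z_{m-1}^{p-1}`. Then `d(x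
  -- - c) = b` lies one filtration step lower, so `x - c ∈ Z_{m+1}`, while `c ∈ B_m` does not change
  -- the class.
  obtain ⟨b, hb, c, hc, hbc⟩ := (mem_B hr.1 rfl rfl rfl).1 ((page_d_cls_eq_zero h x).1 hx)
  have hx2 := (mem_Z hr.1 hr.2).1 x.2
  have hb2 := (mem_Z rfl rfl).1 hb
  have hc2 := (mem_Z hr.1 rfl).1 hc
  refine ⟨x.1 - c, (mem_Z hr.1 rfl).2 ⟨sub_mem hx2.1 (F_mono (by lia) hc2.1), ?_⟩, ?_⟩
  · rw [map_sub, ← hbc, add_sub_cancel_right]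
    exact F_mono (by lia) hb2.1
  · refine sub_eq_zero.1 (((T.cls m i).map_sub _ _).symm.trans (cls_eq_zero.2 ?_))
    change x.1 - (x.1 - c) ∈ _
    rw [sub_sub_cancel]
    refine Z_to_B ?_
    rwa [show i.1 - 1 = j.1 + m - 1 by lia]

namespace PathData
variable {r : ℕ} {P T : FilteredComplex.{u, v} R} (D : PathData r P T)

/-- The middle projection is not a morphism of filtered complexes, so functoriality is not
available. Instead the cycle is represented by some `w ∈ Z_{m+1}`; since `m + 1 ≤ r`, its middle
component is again in `Z_{m+1}` and represents both sides. -/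
lemma midE_charMap (m m' : ℤ) (hm : m + 1 = m') (h0 : 0 ≤ m) (h1 : m ≤ r) (h : m' ≤ r)
    {i j k : ℤ × ℤ} (hij : (shape m).Rel i j) (hk : (shape m).Rel (i + pathShift r) k)
    (x : LinearMap.ker ((P.page m).d i j).hom)
    (y : LinearMap.ker ((T.page m).d (i + pathShift r) k).hom)
    (hy : y.1 = D.midE m h1 i x.1) :
    D.midE m' h i (charMap (spectralSequence.obj P) m m' hm h0 hij x) =
      charMap (spectralSequence.obj T) m m' hm h0 hk y := by
  obtain ⟨w, hw, hxw⟩ := exists_Z_succ_of_cycle P m m' hm hij x.1 x.2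
  rw [charMap_cls P m m' hm h0 hij w hw x hxw,
    charMap_cls T m m' hm h0 hk _ ((D.mem_Z h (shape_pathShift_deg r i) rfl).1 hw).2.1 y
      (by rw [hy, hxw]; rfl)]
  rfl

/-- The outer components are compatibilities of the morphisms induced by `D.minus` and `D.plus`; the
middle one is `midE_charMap` after undoing the change of signs. -/
lemma pageLow_comm_low (m m' : ℤ) (pq : ℤ × ℤ) (hm : m + 1 = m') (h0 : 0 ≤ m) (h : m' ≤ r)
    (h1 : m ≤ r) (h2 : m ≠ r) :
    HomologicalComplex.homologyMap (D.pageLow m h1) pq ≫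
        (lowIso r (signedSpSe.obj T) m m' pq hm h0 h2).hom =
      ((signedSpSe.obj P).iso m m' pq).hom ≫ (D.pageLow m' h).f pq := by
  refine homology_hom_ext _ (shape_next m pq) _ _ fun x => ?_
  have hx := map_mem_ker (D.pageLow m h1) x.2
  refine (congrArg (lowIso r (signedSpSe.obj T) m m' pq hm h0 h2).hom.hom
    (homologyMap_cycleClass (D.pageLow m h1) (shape_next m pq) x hx)).trans ?_
  refine (lowIso_apply r (signedSpSe.obj T) m m' pq hm h0 h2 ⟨_, hx⟩).trans ?_
  have hker := (mem_ker_twistPage _ _ _ _).1 x.2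
  refine Prod.ext (hom_char (signedSpSe.map D.minus) m m' hm h0 _ x).symm (Prod.ext ?_
    (hom_char (signedSpSe.map D.plus) m m' hm h0 _ x).symm)
  have hy := (mem_ker_twistPage _ _ _ _).1
    (cycMid r h2 (twistPage (T.page m)) _ _ ⟨_, hx⟩).2
  refine (charMap_signedSpSe T m m' hm h0 _ ⟨_, hy⟩ _ rfl).trans ?_
  refine Eq.trans ?_ (congrArg (D.midE m' h pq)
    (charMap_signedSpSe P m m' hm h0 (shape_next m pq) ⟨_, hker⟩ x rfl)).symm
  exact (D.midE_charMap m m' hm h0 h1 h _ _ ⟨_, hker⟩ ⟨_, hy⟩ rfl).symm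

/-- The comparison data of the spectral sequences of an `r`-path of filtered complexes. -/
noncomputable def pathComparison : PathComparison r (signedSpSe.obj P) (signedSpSe.obj T) where
  minus := signedSpSe.map D.minus
  plus := signedSpSe.map D.plus
  low m _ h := D.pageLow m h
  low_minus _ _ _ := rfl
  low_plus _ _ _ := rfl
  low_comm m m' pq hm h0 _ h h1 h2 := D.pageLow_comm_low m m' pq hm h0 h h1 h2
  isIso_low m _ h := D.isIso_pageLow m h

lemma ι_toPath (j : T ⟶ P) (hminus : j ≫ D.minus = 𝟙 T) (hplus : j ≫ D.plus = 𝟙 T)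
    (hmid : ∀ n n' hn (x : T.K.X n), D.mid n n' hn ((j.f.f n).hom x) = 0) :
    signedSpSe.map j ≫ D.pathComparison.toPath = (ιSpSe r).app (signedSpSe.obj T) := by
  have hc : ∀ f : P ⟶ T, j ≫ f = 𝟙 T → signedSpSe.map j ≫ signedSpSe.map f = 𝟙 _ := by
    intro f hf
    rw [← Functor.map_comp, hf, CategoryTheory.Functor.map_id]
  refine D.pathComparison.comp_toPath_eq_ι _ (hc D.minus hminus) fun m h0 h => ?_
  refine HomologicalComplex.Hom.ext (funext fun i => ModuleCat.hom_ext (LinearMap.ext fun w => ?_))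
  refine Prod.ext ?_ (Prod.ext ?_ ?_)
  · exact congrArg (fun t => ((t.hom m h0).f i).hom w) (hc D.minus hminus)
  · obtain ⟨w, rfl⟩ := Submodule.mkQ_surjective _ w
    refine cls_eq_zero.2 ?_
    change D.mid _ _ _ ((j.f.f _).hom w.1) ∈ _
    rw [hmid]
    exact zero_mem _
  · exact congrArg (fun t => ((t.hom m h0).f i).hom w) (hc D.plus hplus)

lemma toPath_natural {P' T' : FilteredComplex.{u, v} R} (D' : PathData r P' T') (g : P ⟶ P')
    (f : T ⟶ T') (hminus : g ≫ D'.minus = D.minus ≫ f) (hplus : g ≫ D'.plus = D.plus ≫ f)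
    (hmid : ∀ n n' hn (x : P.K.X n),
      D'.mid n n' hn ((g.f.f n).hom x) = (f.f.f n').hom (D.mid n n' hn x)) :
    signedSpSe.map g ≫ D'.pathComparison.toPath =
      D.pathComparison.toPath ≫ (pathSpSe r).map (signedSpSe.map f) := by
  have hc : ∀ (p' : P' ⟶ T') (p : P ⟶ T), g ≫ p' = p ≫ f →
      signedSpSe.map g ≫ signedSpSe.map p' = signedSpSe.map p ≫ signedSpSe.map f := by
    intro p' p hp
    rw [← Functor.map_comp, hp, Functor.map_comp]
  refine D.pathComparison.toPath_natural D'.pathComparison _ _ (hc D'.minus D.minus hminus)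
    fun m h0 h => ?_
  refine HomologicalComplex.Hom.ext (funext fun i => ModuleCat.hom_ext (LinearMap.ext fun w => ?_))
  refine Prod.ext ?_ (Prod.ext ?_ ?_)
  · exact congrArg (fun t => ((t.hom m h0).f i).hom w) (hc D'.minus D.minus hminus)
  · obtain ⟨w, rfl⟩ := Submodule.mkQ_surjective _ w
    exact congrArg (T'.cls m _) (Subtype.ext (hmid _ _ _ w.1))
  · exact congrArg (fun t => ((t.hom m h0).f i).hom w) (hc D'.plus D.plus hplus)

end PathData
end FilteredComplex

/-! ### The total complex of the path of a multicomplex. -/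

namespace Multicomplex
variable (A : Multicomplex.{u, v} R)

/-- The identification of two equal bidegrees. -/
def castX {a b : ℤ × ℤ} (h : a = b) : A.X a ⟶ A.X b := eqToHom (congrArg A.X h)

lemma castX_castX {a b c : ℤ × ℤ} (h : a = b) (h' : b = c) (x : A.X a) :
    (A.castX h').hom ((A.castX h).hom x) = (A.castX (h.trans h')).hom x := by
  subst h h'
  rfl

lemma castX_eq_zero_iff {a b : ℤ × ℤ} (h : a = b) (x : A.X a) :
    (A.castX h).hom x = 0 ↔ x = 0 := by
  subst h
  rfl

lemma castX_injective {a b : ℤ × ℤ} (h : a = b) : Function.Injective (A.castX h).hom := by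
  subst h
  exact Function.injective_id

lemma castX_d (m : ℕ) {a a' b b' : ℤ × ℤ} (ha : a = a') (hb : b = b') (x : A.X a) :
    (A.castX hb).hom ((A.d m a b).hom x) = (A.d m a' b').hom ((A.castX ha).hom x) := by
  subst ha hb
  rfl

lemma castX_conn (r : ℕ) {a b : ℤ × ℤ} (h : b + pathShift r = a) (x : A.X a) :
    (A.castX h).hom ((conn r r A.X a b).hom x) = x := by
  subst h
  rw [conn, dif_pos ⟨rfl, rfl⟩]
  rfl

lemma castX_natural {A B : Multicomplex.{u, v} R} (f : A ⟶ B) {a b : ℤ × ℤ} (h : a = b)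
    (x : A.X a) : (B.castX h).hom ((f.f a).hom x) = (f.f b).hom ((A.castX h).hom x) := by
  subst h
  rfl

/-- This is the source of both shifts in `PathData`: the middle entry at index `j` in degree `n` is
the entry at index `j + r` of a family in degree `n - 1`. -/
lemma add_pathShift_tot (r : ℕ) {n n' j k : ℤ} (hn : n' + 1 = n) (hk : j + r = k) :
    ((j, n + j) : ℤ × ℤ) + pathShift r = (k, n' + k) := by
  refine Prod.ext hk ?_
  change n + j + ((r : ℤ) - 1) = n' + k
  lia

/-- The second component of the index `j` of a family in the total complex of the `r`-path, viewed
as the component of index `k = j + r` of a family of degree `n' = n - 1`. -/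
noncomputable def midComp (r : ℕ) (n n' : ℤ) (hn : n' + 1 = n) (j k : ℤ) (hk : j + r = k) :
    ((A.path r).X (j, n + j)) →ₗ[R] A.X (k, n' + k) :=
  (A.castX (add_pathShift_tot r hn hk)).hom ∘ₗ
    LinearMap.fst R (A.X ((j, n + j) + pathShift r)) (A.X (j, n + j)) ∘ₗ
      LinearMap.snd R (A.X (j, n + j)) (A.X ((j, n + j) + pathShift r) × A.X (j, n + j))

/-- The second component of a family in the total complex of the `r`-path. -/
noncomputable def totMid (r : ℕ) (n n' : ℤ) (hn : n' + 1 = n) : (A.path r).tot n →ₗ[R] A.tot n' :=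
  LinearMap.restrict
    (LinearMap.pi fun k => A.midComp r n n' hn (k - r) k (sub_add_cancel _ _) ∘ₗ
      LinearMap.proj (k - r)) (by
    rintro w ⟨p, hp⟩
    refine ⟨p + r, fun k hk => ?_⟩
    refine (congrArg (A.midComp r n n' hn (k - r) k (sub_add_cancel _ _))
      (hp (k - r) (by lia))).trans (map_zero (A.midComp r n n' hn (k - r) k _)))

lemma totMid_apply (r : ℕ) (n n' : ℤ) (hn : n' + 1 = n) (w : (A.path r).tot n) (j k : ℤ)
    (hk : j + r = k) :
    (A.totMid r n n' hn w).1 k = A.midComp r n n' hn j k hk (w.1 j) := by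
  obtain rfl : j = k - r := by lia
  rfl

/-- The difference of the third and the first component. -/
noncomputable def pathDiff (r : ℕ) (a : ℤ × ℤ) : (A.path r).X a →ₗ[R] A.X a :=
  LinearMap.snd R (A.X (a + pathShift r)) (A.X a) ∘ₗ
    LinearMap.snd R (A.X a) (A.X (a + pathShift r) × A.X a) -
  LinearMap.fst R (A.X a) (A.X (a + pathShift r) × A.X a)

lemma midComp_d (r : ℕ) (n n' n'' : ℤ) (hn : n' + 1 = n) (hn' : n + 1 = n'') (j k : ℤ)
    (hk : j + r = k) (m : ℕ) (x : (A.path r).X (j + m, n + (j + m))) :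
    A.midComp r n'' n hn' j k hk
        (((A.path r).d m (j + m, n + (j + m)) (j, n'' + j)).hom x) =
      pathSign r m • (A.d m (k + m, n' + (k + m)) (k, n + k)).hom
        (A.midComp r n n' hn (j + m) (k + m) (by lia) x) +
      (A.castX (add_pathShift_tot r hn' hk)).hom
        ((conn r m A.X (j + m, n + (j + m)) (j, n'' + j)).hom (A.pathDiff r _ x)) := by
  refine (map_add (A.castX (add_pathShift_tot r hn' hk)).hom _ _).trans ?_
  refine congrArg (· + _) ?_
  refine (map_zsmul (A.castX (add_pathShift_tot r hn' hk)).hom _ _).trans ?_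
  exact congrArg (pathSign r m • ·) (A.castX_d m _ _ _)

/-- The exponents differ by `2m`. The factor `(-1)^{m+r+1}` in the path of a multicomplex is exactly
what turns the totalisation sign of degree `n` into that of degree `n - 1`, up to a factor
`(-1)^{r+1}` independent of `m`, which can then leave the sum. -/
lemma pathSign_mul_negOnePow (r m : ℕ) (n n' : ℤ) (hn : n' + 1 = n) :
    ((((m : ℤ) * n).negOnePow : ℤˣ) : ℤ) * pathSign r m =
      ((((r : ℤ) + 1).negOnePow : ℤˣ) : ℤ) * ((((m : ℤ) * n').negOnePow : ℤˣ) : ℤ) := by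
  subst hn
  unfold pathSign
  rw [← Units.val_mul, ← Units.val_mul, ← Int.negOnePow_add, ← Int.negOnePow_add,
    show (m : ℤ) * (n' + 1) + (m + r + 1) = (r + 1 + m * n') + 2 * m by ring, Int.negOnePow_add,
    Int.negOnePow_even (2 * _) (even_two_mul _), mul_one]

/-- The connecting term contributes only for `m = r`, where the source index `j + r` is `k`, so it
reads the entry of `w` at `k`. -/
lemma midComp_totTerm (r : ℕ) (n n' n'' : ℤ) (hn : n' + 1 = n) (hn' : n + 1 = n'')
    (w : (A.path r).tot n) (j k : ℤ) (hk : j + r = k) (m : ℕ) :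
    A.midComp r n'' n hn' j k hk ((A.path r).totTerm n n'' j w.1 m) =
      ((((r : ℤ) + 1).negOnePow : ℤˣ) : ℤ) • A.totTerm n' n k (A.totMid r n n' hn w).1 m +
      if m = r then ((((r : ℤ) * n).negOnePow : ℤˣ) : ℤ) • A.pathDiff r (k, n + k) (w.1 k)
        else 0 := by
  unfold totTerm
  rw [map_zsmul, A.midComp_d r n n' n'' hn hn', smul_add, smul_smul, smul_smul,
    pathSign_mul_negOnePow r m n n' hn, A.totMid_apply r n n' hn w (j + m) (k + m) (by lia)]
  congr 1
  split_ifs with hm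
  · subst hm
    subst hk
    exact congrArg (fun t => ((((m : ℤ) * n).negOnePow : ℤˣ) : ℤ) • t) (A.castX_conn m _ _)
  · rw [conn_of_ne (by exact_mod_cast hm), ModuleCat.hom_zero, LinearMap.zero_apply, map_zero,
      smul_zero]

/-- The map of total complexes induced in degree `n`. -/
noncomputable abbrev totMap (A B : Multicomplex.{u, v} R) (f : A ⟶ B) (n : ℤ) :
    A.tot n →ₗ[R] B.tot n := ((Tot.map f).f.f n).hom

lemma totMid_totD (r : ℕ) (n n' n'' : ℤ) (hn : n' + 1 = n) (hn' : n + 1 = n'')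
    (w : (A.path r).tot n) :
    A.totMid r n'' n hn' ((A.path r).totD n n'' w) =
      ((((r : ℤ) + 1).negOnePow : ℤˣ) : ℤ) • A.totD n' n (A.totMid r n n' hn w) +
      ((((r : ℤ) * n).negOnePow : ℤˣ) : ℤ) • (totMap (A.path r) A ((plus r).app A) n w -
        totMap (A.path r) A ((minus r).app A) n w) := by
  obtain ⟨p, hp⟩ : ∃ p, w.1 ∈ (A.path r).totF p n := w.2
  refine Subtype.ext (funext fun k => ?_)
  -- A common truncation for the two finite sums: terms from `N` on vanish for `w` at index `k - r`
  -- and for its middle component at index `k`. The extra `r + 1` puts `m = r` in range, so the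
  -- connecting term is counted.
  set N : ℕ := (p + r - k + 1).toNat + r + 1
  have hj : k - r + r = k := sub_add_cancel _ _
  have hmid : (A.totMid r n n' hn w).1 ∈ A.totF (p + r) n' := fun i hi => by
    rw [A.totMid_apply r n n' hn w (i - r) i (by lia), hp _ (by lia), map_zero]
  rw [A.totMid_apply r n'' n hn' _ (k - r) k hj, (A.path r).totD_apply n n'' w (k - r) (N := N)
    (fun m hm => (A.path r).totTerm_eq_zero hp (by lia)), map_sum,
    Finset.sum_congr rfl fun m _ => A.midComp_totTerm r n n' n'' hn hn' w (k - r) k hj m,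
    Finset.sum_add_distrib, ← Finset.smul_sum, Finset.sum_ite_eq' (Finset.range N) r,
    if_pos (Finset.mem_range.2 (by lia)), ← A.totD_apply n' n (A.totMid r n n' hn w) k (N := N)
    (fun m hm => A.totTerm_eq_zero hmid (by lia))]
  rfl

lemma mem_totF_path (r : ℕ) (p n n' : ℤ) (hn : n' + 1 = n) (w : (A.path r).tot n) :
    w.1 ∈ (A.path r).totF p n ↔
      (totMap (A.path r) A ((minus r).app A) n w).1 ∈ A.totF p n ∧
      (A.totMid r n n' hn w).1 ∈ A.totF (p + r) n' ∧
      (totMap (A.path r) A ((plus r).app A) n w).1 ∈ A.totF p n := by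
  constructor
  · intro h
    refine ⟨fun i hi => congrArg (fun t => t.1) (h i hi), fun i hi => ?_,
      fun i hi => congrArg (fun t => t.2.2) (h i hi)⟩
    rw [A.totMid_apply r n n' hn w (i - r) i (by lia), h _ (by lia), map_zero]
  · rintro ⟨h1, h2, h3⟩ i hi
    refine Prod.ext (h1 i hi) (Prod.ext ?_ (h3 i hi))
    have h4 := h2 (i + r) (by lia)
    rw [A.totMid_apply r n n' hn w i (i + r) rfl] at h4
    exact (A.castX_eq_zero_iff _ _).1 h4

/-- The total complex of the `r`-path of a multicomplex is an `r`-path of its total complex. -/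
noncomputable def totPathData (r : ℕ) :
    FilteredComplex.PathData r (Tot.obj ((pathFunctor r).obj A)) (Tot.obj A) where
  minus := Tot.map ((minus r).app A)
  plus := Tot.map ((plus r).app A)
  mid n n' hn := A.totMid r n n' hn
  mid_d n n' n'' hn hn' w := A.totMid_totD r n n' n'' hn hn' w
  ext n n' hn w w' h1 h2 h3 := by
    refine Subtype.ext (funext fun i => Prod.ext ?_ (Prod.ext ?_ ?_))
    · exact congrFun (congrArg Subtype.val h1) i
    · have h4 := congrFun (congrArg Subtype.val h2) (i + r)
      exact A.castX_injective _ ((A.totMid_apply r n n' hn w i (i + r) rfl).symm.trans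
        (h4.trans (A.totMid_apply r n n' hn w' i (i + r) rfl)))
    · exact congrFun (congrArg Subtype.val h3) i
  exists_eq n n' hn x z y := by
    obtain ⟨p₁, h₁⟩ := x.2
    obtain ⟨p₂, h₂⟩ := y.2
    obtain ⟨p₃, h₃⟩ := z.2
    -- The bound for `y` works without subtracting `r`, since `i > p₂` implies `i + r > p₂`.
    refine ⟨⟨fun i => (x.1 i, (A.castX (add_pathShift_tot r hn rfl).symm).hom (y.1 (i + r)), z.1 i),
      max (max p₁ p₂) p₃, fun i hi => Prod.ext (h₁ i (by lia)) (Prod.ext ?_ (h₃ i (by lia)))⟩, rfl,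
      ?_, rfl⟩
    · exact (A.castX_eq_zero_iff _ _).2 (h₂ (i + r) (by lia))
    · refine Subtype.ext (funext fun k => ?_)
      obtain ⟨i, rfl⟩ : ∃ i : ℤ, i + r = k := ⟨k - r, by lia⟩
      refine (A.totMid_apply r n n' hn _ i (i + r) rfl).trans ?_
      exact A.castX_castX _ _ _
  mem_F p n n' hn w := A.mem_totF_path r p n n' hn w

end Multicomplex
end SpecSeqPath

/-! ### The natural isomorphism and its compatibilities. -/

namespace SpecSeqPath.Multicomplex
variable {R : Type u} [CommRing R]

/-- The isomorphism `E(P_r(A)) ≅ P(r; E(A))`, natural in `A`. -/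
noncomputable def specSeqPathIso (r : ℕ) :
    pathFunctor.{u, v} (R := R) r ⋙ specSeq ≅ specSeq ⋙ pathSpSe r :=
  NatIso.ofComponents (fun A => @asIso _ _ _ _ _ (A.totPathData r).pathComparison.isIso_toPath) fun {A B} f =>
    (A.totPathData r).toPath_natural (B.totPathData r) (Tot.map ((pathFunctor r).map f))
      -- The two projections are natural by definition; only the middle component involves a
      -- transport between equal bidegrees, which `f` respects.
      (Tot.map f) rfl rfl fun _ _ hn _ => Subtype.ext (funext fun _ =>
        castX_natural f (add_pathShift_tot r hn (sub_add_cancel _ _)) _)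

end SpecSeqPath.Multicomplex

theorem mainTheorem10 {R : Type u} [CommRing R] (r : ℕ) :
    ∃ Φ : SpecSeqPath.Multicomplex.pathFunctor.{u, v} (R := R) r ⋙
          SpecSeqPath.Multicomplex.specSeq ≅
        SpecSeqPath.Multicomplex.specSeq ⋙ SpecSeqPath.pathSpSe r,
      ∀ A : SpecSeqPath.Multicomplex.{u, v} R,
        SpecSeqPath.Multicomplex.specSeq.map ((SpecSeqPath.Multicomplex.ι r).app A) ≫
            Φ.hom.app A =
          (SpecSeqPath.ιSpSe r).app (SpecSeqPath.Multicomplex.specSeq.obj A) ∧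
        Φ.hom.app A ≫
            (SpecSeqPath.minusSpSe r).app (SpecSeqPath.Multicomplex.specSeq.obj A) =
          SpecSeqPath.Multicomplex.specSeq.map ((SpecSeqPath.Multicomplex.minus r).app A) ∧
        Φ.hom.app A ≫
            (SpecSeqPath.plusSpSe r).app (SpecSeqPath.Multicomplex.specSeq.obj A) =
          SpecSeqPath.Multicomplex.specSeq.map ((SpecSeqPath.Multicomplex.plus r).app A) := by
  open SpecSeqPath.Multicomplex in
  refine ⟨specSeqPathIso r, fun A => ⟨?_, ?_, ?_⟩⟩
  -- The middle component of `(x, 0, x)` is the transport of zero.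
  · exact (A.totPathData r).ι_toPath (Tot.map ((ι r).app A)) rfl rfl fun _ _ _ _ =>
      Subtype.ext (funext fun _ => map_zero (A.castX _).hom)
  · exact (A.totPathData r).pathComparison.toPath_minus
  · exact (A.totPathData r).pathComparison.toPath_plus
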